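/- **Setting.** Fix a finite set of labels. A decorated rooted forest is a finite rooted forest in which each non-root vertex carries a label (labels may repeat); forests are taken up to isomorphism preserving roots, parents and labels. The decorated Connes–Kreimer algebra $\mathcal H$ is the real vector space with basis these forests, graded by the number of vertices, with product the disjoint union $\amalg$ and coproduct $\Delta(x)=\sum_U x|_U\otimes x|_{V(x)\setminus U}$, where $U$ runs over the sets of vertices of $x$ closed under taking children and a vertex that loses its parent becomes an unlabelled root. Let $\bullet$ be the one-vertex forest. For a weak composition $D=(d_1,\dots,d_l)$ of $n$ let $\Delta_D$ be the component of the iterated coproduct in $\mathcal H_{d_1}\otimes\dots\otimes\mathcal H_{d_l}$, let $m$ be the multiplication of tensor factors, and put $$\mathrm{T2R}_n=\tfrac1n\,m\Delta_{1,n-1},\qquad \mathrm{BinT2R}_n(q_2)=\sum_{r=0}^n\tfrac1{r!}(1-q_2)^r q_2^{\,n-r}\,m\Delta_{1^r,n-r}.$$ Let $\eta(x)$ be the sum of the coefficients of $\Delta_{1,\dots,1}(x)$. The chain driven by an operator $\mathbf T$ on the forests with $n$ vertices has transition probabilities $\hat K(x,y)=\frac{\eta(y)}{\eta(x)}\cdot(\text{coefficient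 of }y\text{ in }\mathbf T(x))$. **Employee-firing chains.** Let $T_0$ be a decorated rooted tree on $n_0$ vertices, whose vertices are the positions in a company. A rooted subtree of $T_0$ is a connected set of vertices containing the root; these are the states of the chains (the sets of filled positions). When an employee is fired, a cascade of promotions follows: someone chosen uniformly among those further down from the fired employee is promoted to his position; if there is anybody further down from the position thus vacated, one of those is chosen uniformly and promoted to it, and so on, until a leaf position is vacated. Different firings cause independent cascades. No firing occurs when only one employee (the boss) remains. - *Single model*: if $n$ employees are left, then with probability $n/n_0$ one uniformly chosen employee is fired, and with probability $(n_0-n)/n_0$ nothing changes. - *Binomial model* with parameter $q_2\in[0,1]$: each employee left (including the boss) independently has a performance uniform on $[0,1]$; all those with performance below $1-q_2$ are fired one by one in a uniformly random order. **Theorem.** The chains driven by $\mathrm{T2R}_{n_0}$ and $\mathrm{BinT2R}_{n_0}(q_2)$, $0\le q_2\le1$, started from $T_0$, remain in the set of states $$\{\bullet^{n_0-n}\amalg T \mid T\text{ is a rooted subtree of }T_0\text{ on }n\text{ vertices}\}.$$ For rooted subtrees $T,T'$ of $T_0$ on $n,n'$ vertices, $\bullet^{n_0-n}\amalg T=\bullet^{n_0-n'}\amalg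 T'$ if and only if $T\cong T'$ as decorated trees, and under the identification $\bullet^{n_0-n}\amalg T\mapsto T$ the two chains are the single model and the binomial model, respectively: for every rooted subtree $T$ and every forest $y$ on $n_0$ vertices, $\hat K(\bullet^{n_0-n}\amalg T,\,y)$ is the probability that the model moves in one step from $T$ to some rooted subtree $T'$ with $\bullet^{n_0-n'}\amalg T'=y$. In particular, if the labels of $T_0$ are pairwise distinct, then $\hat K(\bullet^{n_0-n}\amalg T,\bullet^{n_0-n'}\amalg T')$ is the probability of moving from the vertex set $T$ to the vertex set $T'$. Moreover, in the single model, as long as at least two employees are left, choosing the fired employee uniformly from all employees or only from the non-boss employees gives the same transition probabilities. -/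

import Mathlib

noncomputable section

namespace CKTree

/-! ### Decorated rooted forests -/

/-- A decorated rooted forest on the vertex set `V` with labels in `L`. `up v = none` says that
`v` is a root (roots carry no label), `up v = some (w, l)` says that `v` is a child of `w` and has
the label `l`. Well-foundedness of the parent relation excludes cycles (on a finite `V`). -/
structure DForest (L : Type*) (V : Type*) where
  up : V → Option (V × L)
  wf : WellFounded fun w v : V => ∃ l, up v = some (w, l)

namespace DForest

variable {L V W X Y : Type*}

/-- `w` is the parent of `v`. -/
def IsParent (F : DForest L V) (w v : V) : Prop := ∃ l, F.up v = some (w, l)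

/-- `u` lies strictly below `v`, i.e. is a child, a grandchild, ... of `v`. -/
def Below (F : DForest L V) (u v : V) : Prop := Relation.TransGen F.IsParent v u

/-- Isomorphism of decorated rooted forests: a bijection of the vertices that preserves roots,
parents and labels. -/
def Iso (F : DForest L V) (G : DForest L W) : Prop :=
  ∃ e : V ≃ W, ∀ v, G.up (e v) = (F.up v).map (Prod.map e id)

theorem Iso.refl (F : DForest L V) : F.Iso F := ⟨Equiv.refl V, fun v => by simp⟩

theorem Iso.symm {F : DForest L V} {G : DForest L W} : F.Iso G → G.Iso F := by
  rintro ⟨e, he⟩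
  refine ⟨e.symm, fun w => ?_⟩
  have h := he (e.symm w)
  rw [Equiv.apply_symm_apply] at h
  rw [h, Option.map_map]
  have : (Prod.map e.symm id ∘ Prod.map e id : V × L → V × L) = id := by
    ext x <;> simp
  rw [this]; simp

theorem Iso.trans {F : DForest L V} {G : DForest L W} {H : DForest L X} :
    F.Iso G → G.Iso H → F.Iso H := by
  rintro ⟨e, he⟩ ⟨f, hf⟩
  refine ⟨e.trans f, fun v => ?_⟩
  rw [Equiv.trans_apply, hf, he, Option.map_map]
  rfl

/-- The copy of a forest along a bijection of the vertex set. -/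
def transport (F : DForest L V) (e : V ≃ W) : DForest L W where
  up w := (F.up (e.symm w)).map (Prod.map e id)
  wf := by
    refine Subrelation.wf ?_ (InvImage.wf e.symm F.wf)
    rintro a b ⟨l, h⟩
    rw [Option.map_eq_some_iff] at h
    obtain ⟨⟨c, l'⟩, hc, hc'⟩ := h
    simp only [Prod.map_apply, id, Prod.mk.injEq] at hc'
    refine ⟨l', ?_⟩
    rw [hc, ← hc'.1, Equiv.symm_apply_apply]

theorem iso_transport (F : DForest L V) (e : V ≃ W) : F.Iso (F.transport e) :=
  ⟨e, fun v => by simp [transport]⟩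

open Classical in
/-- The forest induced on a set `s` of vertices; a vertex whose parent is not in `s` becomes a
root, and so loses its label. -/
def restrict (F : DForest L V) (s : Finset V) : DForest L {v // v ∈ s} where
  up v := (F.up v).bind fun p => if h : p.1 ∈ s then some (⟨p.1, h⟩, p.2) else none
  wf := by
    refine Subrelation.wf ?_ (InvImage.wf Subtype.val F.wf)
    rintro a b ⟨l, h⟩
    rw [Option.bind_eq_some_iff] at h
    obtain ⟨⟨c, l'⟩, hc, hc'⟩ := h
    split_ifs at hc' with hs
    refine ⟨l', ?_⟩
    simp only [Option.some.injEq, Prod.mk.injEq] at hc'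
    rw [hc, ← hc'.1]

/-- The disjoint union of two forests. -/
def sum (F : DForest L V) (G : DForest L W) : DForest L (V ⊕ W) where
  up := Sum.elim (fun v => (F.up v).map (Prod.map Sum.inl id))
    (fun w => (G.up w).map (Prod.map Sum.inr id))
  wf := by
    have hl : ∀ v : V, Acc (fun a b : V ⊕ W => ∃ l, Sum.elim
        (fun v => (F.up v).map (Prod.map Sum.inl id))
        (fun w => (G.up w).map (Prod.map Sum.inr id)) b = some (a, l)) (Sum.inl v) := by
      intro v
      induction v using F.wf.induction with
      | _ v ih =>
        refine Acc.intro _ ?_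
        rintro a ⟨l, h⟩
        rw [Sum.elim_inl, Option.map_eq_some_iff] at h
        obtain ⟨⟨c, l'⟩, hc, hc'⟩ := h
        simp only [Prod.map_apply, id, Prod.mk.injEq] at hc'
        rw [← hc'.1]
        exact ih c ⟨l', hc⟩
    have hr : ∀ v : W, Acc (fun a b : V ⊕ W => ∃ l, Sum.elim
        (fun v => (F.up v).map (Prod.map Sum.inl id))
        (fun w => (G.up w).map (Prod.map Sum.inr id)) b = some (a, l)) (Sum.inr v) := by
      intro v
      induction v using G.wf.induction with
      | _ v ih =>
        refine Acc.intro _ ?_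
        rintro a ⟨l, h⟩
        rw [Sum.elim_inr, Option.map_eq_some_iff] at h
        obtain ⟨⟨c, l'⟩, hc, hc'⟩ := h
        simp only [Prod.map_apply, id, Prod.mk.injEq] at hc'
        rw [← hc'.1]
        exact ih c ⟨l', hc⟩
    exact ⟨fun x => x.casesOn hl hr⟩

/-- The forest all of whose vertices are roots. -/
def discrete (L V : Type*) : DForest L V where
  up _ := none
  wf := ⟨fun v => Acc.intro v (by rintro w ⟨l, h⟩; simp at h)⟩

theorem Iso.sum {F : DForest L V} {G : DForest L W} {F' : DForest L X} {G' : DForest L Y} :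
    F.Iso F' → G.Iso G' → (F.sum G).Iso (F'.sum G') := by
  rintro ⟨e, he⟩ ⟨f, hf⟩
  refine ⟨Equiv.sumCongr e f, ?_⟩
  rintro (v | w)
  · simp [DForest.sum, he]; rfl
  · simp [DForest.sum, hf]; rfl

end DForest

/-- The isomorphism relation on forests with vertex set `{0, …, n - 1}`. -/
instance forestSetoid (L : Type*) : Setoid (Σ n : ℕ, DForest L (Fin n)) where
  r F G := F.2.Iso G.2
  iseqv := ⟨fun F => DForest.Iso.refl F.2, DForest.Iso.symm, DForest.Iso.trans⟩

/-- The decorated rooted forests, up to isomorphism. -/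
def ForestClass (L : Type*) : Type _ := Quotient (forestSetoid L)

namespace DForest

variable {L V W X : Type*} [Fintype V] [Fintype W] [Fintype X]

/-- The isomorphism class of a forest on any finite vertex set. -/
def toClass (F : DForest L V) : ForestClass L :=
  Quotient.mk (forestSetoid L) ⟨Fintype.card V, F.transport (Fintype.equivFin V)⟩

theorem toClass_eq_iff {F : DForest L V} {G : DForest L W} : F.toClass = G.toClass ↔ F.Iso G := by
  unfold toClass
  refine Quotient.eq.trans ⟨fun h => ?_, fun h => ?_⟩
  · exact (F.iso_transport _).trans (Iso.trans h (G.iso_transport _).symm)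
  · exact Iso.trans (F.iso_transport _).symm (h.trans (G.iso_transport _))

theorem mk_eq_toClass (F : Σ n : ℕ, DForest L (Fin n)) :
    Quotient.mk (forestSetoid L) F = F.2.toClass :=
  Quotient.sound (F.2.iso_transport _)

end DForest

namespace ForestClass

variable {L : Type*}

theorem ind {p : ForestClass L → Prop} (h : ∀ (n : ℕ) (F : DForest L (Fin n)), p F.toClass)
    (x : ForestClass L) : p x := by
  induction x using Quotient.inductionOn with
  | _ F => rw [DForest.mk_eq_toClass]; exact h F.1 F.2

/-- The degree of a forest: its number of vertices. -/
def degree (x : ForestClass L) : ℕ :=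
  Quotient.lift (fun F : Σ n : ℕ, DForest L (Fin n) => F.1) (by
    rintro ⟨m, F⟩ ⟨n, G⟩ ⟨e, -⟩
    simpa using Fintype.card_congr e) x

theorem degree_toClass {V : Type*} [Fintype V] (F : DForest L V) :
    F.toClass.degree = Fintype.card V := rfl

/-- The product of two forests is their disjoint union. -/
instance : Mul (ForestClass L) where
  mul := Quotient.map₂
    (fun F G => ⟨Fintype.card (Fin F.1 ⊕ Fin G.1), (F.2.sum G.2).transport (Fintype.equivFin _)⟩)
    (fun _ _ h _ _ k => (DForest.iso_transport _ _).symm.trans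
      ((DForest.Iso.sum h k).trans (DForest.iso_transport _ _)))

/-- The empty forest. -/
instance : One (ForestClass L) := ⟨(DForest.discrete L (Fin 0)).toClass⟩

theorem toClass_mul_toClass {V W : Type*} [Fintype V] [Fintype W] (F : DForest L V)
    (G : DForest L W) : F.toClass * G.toClass = (F.sum G).toClass :=
  Quotient.sound ((DForest.iso_transport _ _).symm.trans
    ((DForest.Iso.sum (DForest.iso_transport _ _).symm (DForest.iso_transport _ _).symm).trans
      (DForest.iso_transport _ _)))

instance : CommMonoid (ForestClass L) where
  mul_assoc x y z := by
    induction x using ForestClass.ind with | _ a F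
    induction y using ForestClass.ind with | _ b G
    induction z using ForestClass.ind with | _ c H
    rw [toClass_mul_toClass, toClass_mul_toClass, toClass_mul_toClass, toClass_mul_toClass,
      DForest.toClass_eq_iff]
    refine ⟨Equiv.sumAssoc _ _ _, ?_⟩
    rintro ((v | v) | v)
    · simp [DForest.sum]; rfl
    · simp [DForest.sum]; rfl
    · simp [DForest.sum]; rfl
  mul_comm x y := by
    induction x using ForestClass.ind with | _ a F
    induction y using ForestClass.ind with | _ b G
    rw [toClass_mul_toClass, toClass_mul_toClass, DForest.toClass_eq_iff]
    refine ⟨Equiv.sumComm _ _, ?_⟩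
    rintro (v | v)
    · simp [DForest.sum]; rfl
    · simp [DForest.sum]; rfl
  one_mul x := by
    induction x using ForestClass.ind with | _ a F
    change (DForest.discrete L (Fin 0)).toClass * _ = _
    rw [toClass_mul_toClass, DForest.toClass_eq_iff]
    refine ⟨Equiv.emptySum _ _, ?_⟩
    rintro (v | v)
    · exact v.elim0
    · have h : (Prod.map (Equiv.emptySum (Fin 0) (Fin a)) id ∘ Prod.map Sum.inr id :
          Fin a × L → Fin a × L) = id := by ext x <;> simp
      simp [DForest.sum, h]
  mul_one x := by
    induction x using ForestClass.ind with | _ a F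
    change _ * (DForest.discrete L (Fin 0)).toClass = _
    rw [toClass_mul_toClass, DForest.toClass_eq_iff]
    refine ⟨Equiv.sumEmpty _ _, ?_⟩
    rintro (v | v)
    · have h : (Prod.map (Equiv.sumEmpty (Fin a) (Fin 0)) id ∘ Prod.map Sum.inl id :
          Fin a × L → Fin a × L) = id := by ext x <;> simp
      simp [DForest.sum, h]
    · exact v.elim0

/-- The forest with one vertex. -/
def bullet (L : Type*) : ForestClass L := (DForest.discrete L (Fin 1)).toClass

theorem degree_mul (x y : ForestClass L) : (x * y).degree = x.degree + y.degree := by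
  induction x using ForestClass.ind with | _ a F
  induction y using ForestClass.ind with | _ b G
  rw [toClass_mul_toClass, degree_toClass, degree_toClass, degree_toClass, Fintype.card_sum]

theorem degree_bullet_pow (k : ℕ) : (bullet L ^ k).degree = k := by
  induction k with
  | zero => rfl
  | succ k ih => rw [pow_succ, degree_mul, ih]; rfl

end ForestClass

/-- The forests with `n` vertices. -/
abbrev Basis (L : Type*) (n : ℕ) : Type _ := {x : ForestClass L // x.degree = n}

instance (L : Type*) [Finite L] (n : ℕ) : Finite (Basis L n) := by
  have h : Finite (DForest L (Fin n)) :=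
    Finite.of_injective DForest.up (by rintro ⟨u, _⟩ ⟨u', _⟩ h; simpa using h)
  refine Finite.of_surjective
    (fun F : DForest L (Fin n) => (⟨F.toClass, by simp [ForestClass.degree_toClass]⟩ : Basis L n)) ?_
  rintro ⟨x, hx⟩
  induction x using ForestClass.ind with | _ a F
  rw [ForestClass.degree_toClass, Fintype.card_fin] at hx
  subst hx
  exact ⟨F, rfl⟩

instance (L : Type*) [Finite L] (n : ℕ) : Fintype (Basis L n) := Fintype.ofFinite _

instance (L : Type*) (n : ℕ) : DecidableEq (Basis L n) := Classical.decEq _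

/-! ### The decorated Connes–Kreimer algebra -/

open TensorProduct

/-- The decorated Connes–Kreimer algebra: the real vector space with basis the decorated rooted
forests; the product is the bilinear extension of disjoint union. -/
abbrev CK (L : Type*) : Type _ := MonoidAlgebra ℝ (ForestClass L)

section Hopf

variable {L : Type*}

/-- The basis element of a forest. -/
def basisVec (x : ForestClass L) : CK L := MonoidAlgebra.single x 1

/-- Linear extension from the basis of forests. -/
def linExt {M : Type*} [AddCommMonoid M] [Module ℝ M] (f : ForestClass L → M) : CK L →ₗ[ℝ] M :=
  (MonoidAlgebra.basis (ForestClass L) ℝ).constr ℝ f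

open Classical in
/-- The coproduct of a forest: the sum over the admissible cuts, i.e. over the sets `U` of vertices
that contain with a vertex all its children, of (the pruned part `U`) ⊗ (the remaining trunk). -/
def forestCoproduct {V : Type*} [Fintype V] (F : DForest L V) : CK L ⊗[ℝ] CK L :=
  ∑ U : Finset V with ∀ w v, F.IsParent w v → w ∈ U → v ∈ U,
    basisVec (F.restrict U).toClass ⊗ₜ[ℝ] basisVec (F.restrict Uᶜ).toClass

theorem forestCoproduct_congr {V W : Type*} [Fintype V] [Fintype W] {F : DForest L V}
    {G : DForest L W} (h : F.Iso G) : forestCoproduct F = forestCoproduct G := by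
  classical
  obtain ⟨e, he⟩ := h
  have hpar : ∀ w v, G.IsParent (e w) (e v) ↔ F.IsParent w v := by
    intro w v
    unfold DForest.IsParent
    simp [he]
  have hres : ∀ (U : Finset V) (U' : Finset W), (∀ v, e v ∈ U' ↔ v ∈ U) →
      (F.restrict U).toClass = (G.restrict U').toClass := by
    intro U U' hU
    rw [DForest.toClass_eq_iff]
    refine ⟨e.subtypeEquiv fun v => (hU v).symm, fun v => ?_⟩
    simp only [DForest.restrict, Equiv.subtypeEquiv_apply, he]
    rcases F.up v with _ | ⟨c, l⟩
    · rfl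
    · by_cases hc : c ∈ U
      · simp [hc, (hU c).2 hc]
      · simp [hc, (hU c).not.2 hc]
  unfold forestCoproduct
  refine Finset.sum_equiv e.finsetCongr ?_ ?_
  · intro U
    simp only [Finset.mem_filter, Finset.mem_univ, true_and, Equiv.finsetCongr_apply]
    constructor
    · intro h w v hwv hw
      obtain ⟨w, rfl⟩ := e.surjective w
      obtain ⟨v, rfl⟩ := e.surjective v
      simp only [Finset.mem_map_equiv, Equiv.symm_apply_apply] at hw ⊢
      exact h w v ((hpar w v).1 hwv) hw
    · intro h w v hwv hw
      have := h (e w) (e v) ((hpar w v).2 hwv) (by simpa using hw)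
      simpa using this
  · intro U _
    rw [hres U (e.finsetCongr U) (by simp), hres Uᶜ (e.finsetCongr U)ᶜ (by simp)]

/-- The coproduct `Δ`. -/
def coproduct (L : Type*) : CK L →ₗ[ℝ] CK L ⊗[ℝ] CK L :=
  linExt (Quotient.lift (fun F : Σ n : ℕ, DForest L (Fin n) => forestCoproduct F.2)
    fun _ _ h => forestCoproduct_congr h)

open Classical in
/-- The counit. -/
def counit (L : Type*) : CK L →ₗ[ℝ] ℝ := linExt fun x => if x = 1 then 1 else 0

/-- The projection onto the homogeneous component of degree `d`. -/
def proj (L : Type*) (d : ℕ) : CK L →ₗ[ℝ] CK L :=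
  linExt fun x => if x.degree = d then basisVec x else 0

/-- The refined coproduct `Δ_D` for a weak composition `D = (d₁, …, d_l)`: the iterated coproduct
followed by the projection to the component of degrees `d₁, …, d_l`, with values in the `l`-th
tensor power of the algebra, seen inside the tensor algebra. -/
def refinedCoproduct (L : Type*) : List ℕ → CK L →ₗ[ℝ] TensorAlgebra ℝ (CK L)
  | [] => Algebra.linearMap ℝ (TensorAlgebra ℝ (CK L)) ∘ₗ counit L
  | d :: D => LinearMap.mul' ℝ (TensorAlgebra ℝ (CK L)) ∘ₗ
      TensorProduct.map (TensorAlgebra.ι ℝ ∘ₗ proj L d) (refinedCoproduct L D) ∘ₗ coproduct L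

/-- The multiplication of arbitrarily many tensor factors. -/
def multiProduct (L : Type*) : TensorAlgebra ℝ (CK L) →ₐ[ℝ] CK L :=
  TensorAlgebra.lift ℝ LinearMap.id

/-- The operator `m Δ_D`. -/
def descentOp (L : Type*) (D : List ℕ) : CK L →ₗ[ℝ] CK L :=
  (multiProduct L).toLinearMap ∘ₗ refinedCoproduct L D

/-- On a tensor product of homogeneous elements, the sum of the coefficients in the tensor power
of the basis of forests. -/
def sumCoeff (L : Type*) : TensorAlgebra ℝ (CK L) →ₐ[ℝ] ℝ :=
  TensorAlgebra.lift ℝ (linExt fun _ => 1)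

/-- The rescaling function `η(x)`: the sum of the coefficients of `Δ_{1,…,1}(x)`. -/
def eta (x : ForestClass L) : ℝ :=
  sumCoeff L (refinedCoproduct L (List.replicate x.degree 1) (basisVec x))

/-- The top-to-random operator `(1/n) m Δ_{1,n-1}`. -/
def T2R (L : Type*) (n : ℕ) : CK L →ₗ[ℝ] CK L := (1 / (n : ℝ)) • descentOp L [1, n - 1]

/-- The binomial-top-to-random operator with parameter `q`,
`∑_{r=0}^n (1/r!) (1-q)^r q^(n-r) m Δ_{1^r,n-r}`. -/
def BinT2R (L : Type*) (n : ℕ) (q : ℝ) : CK L →ₗ[ℝ] CK L :=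
  ∑ r ∈ Finset.range (n + 1), (1 / (r.factorial : ℝ) * (1 - q) ^ r * q ^ (n - r)) •
    descentOp L (List.replicate r 1 ++ [n - r])

/-- The transition matrix of the chain on the forests with `n` vertices driven by an operator `T`
(the Doob transform of its matrix by `η`). -/
def drivenChain {n : ℕ} (T : CK L →ₗ[ℝ] CK L) : Matrix (Basis L n) (Basis L n) ℝ :=
  Matrix.of fun x y => eta y.1 / eta x.1 * (T (basisVec x.1)).coeff y.1

end Hopf

/-! ### The employee-firing chains -/

section Firing

variable {L V : Type*} (T : DForest L V)

theorem DForest.not_below_self (v : V) : ¬ T.Below v v := by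
  intro h
  exact (WellFounded.transGen T.wf).irrefl.irrefl v h

/-- The graph that underlies a rooted forest. -/
def DForest.graph : SimpleGraph V where
  Adj v w := T.IsParent v w ∨ T.IsParent w v
  symm := ⟨fun _ _ => Or.symm⟩
  loopless := ⟨fun v h => T.not_below_self v (Relation.TransGen.single (h.elim id id))⟩

/-- A rooted subtree of the tree `T` with the given root: a connected set of vertices that
contains the root. -/
def IsRootedSubtree (root : V) (S : Finset V) : Prop :=
  root ∈ S ∧ (T.graph.induce (S : Set V)).Connected

/-- Who sits where in the company: `pos e` is the position of employee `e`, or `none` if `e` is not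
in the company. The positions are the vertices of the tree; an employee is named after the
position that he holds at the start of the month. -/
abbrev Staffing (V : Type*) : Type _ := V → Option V

variable [Fintype V]

open Classical in
/-- The positions that are filled. -/
def filled (pos : Staffing V) : Finset V := {v | ∃ e, pos e = some v}

open Classical in
/-- The employees, with their positions, who are further down the chain of superiority from the
position `v`. -/
def subordinates (pos : Staffing V) (v : V) : Finset (V × V) :=
  {p | pos p.1 = some p.2 ∧ T.Below p.2 v}

open Classical in
/-- The cascade of promotions when the position `v` is vacant: someone further down from `v` is
chosen uniformly and promoted to `v`; his former position is then vacant and is filled in the same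
way. It ends with a vacant position that nobody is below of. -/
def cascade (pos : Staffing V) (v : V) : PMF (Staffing V) :=
  if h : (subordinates T pos v).Nonempty then
    (PMF.uniformOfFinset _ h).bindOnSupport fun p hp =>
      have : Finset.card {u | T.Below u p.2} < Finset.card {u | T.Below u v} := by
        have hb : T.Below p.2 v := by
          have := (PMF.mem_support_uniformOfFinset_iff h p).1 hp
          simp only [subordinates, Finset.mem_filter] at this
          exact this.2.2
        refine Finset.card_lt_card (Finset.ssubset_iff_of_subset ?_ |>.2 ⟨p.2, ?_, ?_⟩)
        · intro u hu
          simp only [Finset.mem_filter, Finset.mem_univ, true_and] at hu ⊢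
          exact Relation.TransGen.trans hb hu
        · simpa using hb
        · simpa using T.not_below_self p.2
      cascade (Function.update pos p.1 (some v)) p.2
  else PMF.pure pos
termination_by Finset.card {u | T.Below u v}

open Classical in
/-- The employee `e` is fired, which causes a cascade of promotions. No firing occurs when only
one employee (the boss) remains. -/
def fire (pos : Staffing V) (e : V) : PMF (Staffing V) :=
  match pos e with
  | none => PMF.pure pos
  | some v => if 1 < (filled pos).card then cascade T (Function.update pos e none) v
      else PMF.pure pos

/-- The employees in a list are fired one by one. -/
def fireList (pos : Staffing V) : List V → PMF (Staffing V)
  | [] => PMF.pure pos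
  | e :: l => (fire T pos e).bind fun pos' => fireList pos' l

open Classical in
/-- The employees in a set are fired one by one, in a uniformly random order. -/
def fireSet (pos : Staffing V) (F : Finset V) : PMF (Staffing V) :=
  (PMF.uniformOfFinset F.toList.permutations.toFinset
    ⟨F.toList, by simp⟩).bind fun l => fireList T pos l

open Classical in
/-- The company at the start of a month, when the filled positions are those in `S`. -/
def startOfMonth (S : Finset V) : Staffing V := fun e => if e ∈ S then some e else none

/-- The probability that the structure `S` of the company becomes `S'` when one employee, chosen
uniformly from `C`, is fired. -/
def uniformFiring (C S S' : Finset V) : ℝ :=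
  ∑ e ∈ C, 1 / (C.card : ℝ) * ((fire T (startOfMonth S) e).map filled S').toReal

open Classical in
/-- The single model: with probability `n / n₀`, where `n` is the current and `n₀` the initial
number of employees, one uniformly chosen employee is fired; otherwise nothing changes. -/
def singleModel : Matrix (Finset V) (Finset V) ℝ := Matrix.of fun S S' =>
  (S.card : ℝ) / Fintype.card V * uniformFiring T S S S' +
    ((Fintype.card V : ℝ) - S.card) / Fintype.card V * (if S' = S then 1 else 0)

/-- The probability that exactly the employees in `F` (a part of `S`) perform below `1 - q`, when
the performances of the employees in `S` are independent and uniform on `[0, 1]`. -/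
def underperformProb (q : ℝ) (S F : Finset V) : ℝ :=
  (MeasureTheory.Measure.pi fun _ : {e // e ∈ S} =>
    MeasureTheory.volume.restrict (Set.Icc (0 : ℝ) 1)).real
      {perf | ∀ e, perf e < 1 - q ↔ (e : V) ∈ F}

/-- The binomial model: all employees with performance below `1 - q` are fired one by one in a
random order. -/
def binomialModel (q : ℝ) : Matrix (Finset V) (Finset V) ℝ := Matrix.of fun S S' =>
  ∑ F ∈ S.powerset, underperformProb q S F *
    ((fireSet T (startOfMonth S) F).map filled S').toReal

/-- The forest `•^(n₀ - n) ⨿ T[S]` of the structure `S` on `n` of the `n₀` vertices of `T`. -/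
def companyState (S : Finset V) : Basis L (Fintype.card V) :=
  ⟨ForestClass.bullet L ^ (Fintype.card V - S.card) * (T.restrict S).toClass, by
    rw [ForestClass.degree_mul, ForestClass.degree_bullet_pow, ForestClass.degree_toClass,
      Fintype.card_coe]
    exact Nat.sub_add_cancel (Finset.card_le_univ S)⟩

/-- The tree `T` itself, as a state. -/
def initialState : Basis L (Fintype.card V) := ⟨T.toClass, rfl⟩

open Classical in
/-- The total weight, under `μ`, of the rooted subtrees `S'` of `T` whose state
`•^(n₀ - n) ⨿ T[S']` is `y`. (Several vertex sets may carry isomorphic decorated trees, unless the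
labels are distinct.) -/
def weightOfState (root : V) (μ : Finset V → ℝ) (y : Basis L (Fintype.card V)) : ℝ :=
  ∑ S' : Finset V with IsRootedSubtree T root S' ∧ companyState T S' = y, μ S'

end Firing

end CKTree

end

/-! Let ∂ (`leafDel`) send a forest to the sum of its one-leaf deletions, and let b be
multiplication by •. A piece of degree 1 that is cut off is a leaf, so m Δ_{1^r,n-r} = b^r ∂^r in
degree n, and η counts the orders in which a forest can be dismantled leaf by leaf. The rest of the
algebra is the relation ∂b = 1 + b∂ (`leafDel_bullet_mul`). It gives η(•^k x) = (deg x + k)!/(deg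
x)! · η(x). It also splits T2R on •^k ⨿ T into a holding term and a leaf-deletion term, and shows
that BinT2R commutes with b (`BinT2R_bullet_mul`).

After rescaling by η, b^k ∂^k acts on a tree with n vertices as n(n-1)⋯(n-k+1) times the k-th power
of `leafStep`, the chain that removes the leaf u of T with probability η(T∖u)/η(T)
(`eta_div_mul_coeff`). Hence T2R mixes one leaf step, with weight n/n₀, with standing still, and
BinT2R is the binomial mixture of the powers of `leafStep`.

On the probabilistic side, a cascade from v is the hook walk (`expect_cascade`). It ends at the leaf
u with probability (1/h_v) ∏ h_w/(h_w - 1), over the proper ancestors w of u up to v, where h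
denotes hook lengths. These weights telescope along the ancestors of u, so a uniform starting point
gives the same law as a start at the root (`sum_hookWalk_eq`). By the hook length formula η(T) =
n!/∏ h, this law is that of `leafStep`. Firing k employees in random order therefore performs k leaf
steps (`sum_expect_fireList`), and independent performances make k binomial.

One discrepancy remains: `leafStep` removes the last vertex, while the boss is never fired when
alone. It is invisible in the states, because ∅ and {root} both give •^{n₀}. States determine trees
up to isomorphism because b is injective and a tree has only one root. -/

noncomputable section

namespace CKTree

open TensorProduct

variable {L V W : Type*}

/-! ### Leaves and induced forests -/

open Classical in
/-- The vertices of `S` without a child in `S`. -/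
def leaves (F : DForest L V) (S : Finset V) : Finset V :=
  {u ∈ S | ∀ w ∈ S, ¬ F.IsParent u w}

theorem mem_leaves {F : DForest L V} {S : Finset V} {u : V} :
    u ∈ leaves F S ↔ u ∈ S ∧ ∀ w ∈ S, ¬ F.IsParent u w := by
  simp [leaves]

theorem DForest.not_isParent_self (F : DForest L V) (v : V) : ¬ F.IsParent v v := fun h =>
  F.not_below_self v (Relation.TransGen.single h)

theorem DForest.restrict_up_eq_some {F : DForest L V} {S : Finset V} {v w : {v // v ∈ S}} {l : L} :
    (F.restrict S).up v = some (w, l) ↔ F.up v = some (w.1, l) := by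
  simp only [DForest.restrict, Option.bind_eq_some_iff]
  constructor
  · rintro ⟨⟨c, m⟩, hc, h⟩
    split_ifs at h with hs
    simp only [Option.some.injEq, Prod.mk.injEq] at h
    rw [hc, ← h.1, h.2]
  · intro h
    exact ⟨_, h, by simp⟩

theorem DForest.isParent_restrict {F : DForest L V} {S : Finset V} {v w : {v // v ∈ S}} :
    (F.restrict S).IsParent v w ↔ F.IsParent v w := by
  simp only [DForest.IsParent, DForest.restrict_up_eq_some]

/-- To be isomorphic it is enough to have the same parent-label relation. -/
theorem DForest.Iso.of_iff {F : DForest L V} {G : DForest L W} (e : V ≃ W)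
    (h : ∀ v w l, F.up v = some (w, l) ↔ G.up (e v) = some (e w, l)) : F.Iso G := by
  refine ⟨e, fun v => Option.ext fun p => ?_⟩
  obtain ⟨w, l⟩ := p
  obtain ⟨w, rfl⟩ := e.surjective w
  rw [← h, Option.map_eq_some_iff]
  constructor
  · intro hv
    exact ⟨_, hv, rfl⟩
  · rintro ⟨⟨a, m⟩, ha, hb⟩
    simp only [Prod.map_apply, id, Prod.mk.injEq, e.injective.eq_iff] at hb
    rw [ha, hb.1, hb.2]

theorem DForest.restrict_univ_iso [Fintype V] (F : DForest L V) :
    (F.restrict Finset.univ).Iso F :=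
  DForest.Iso.of_iff (Equiv.subtypeUnivEquiv fun _ => Finset.mem_univ _) fun _ _ _ =>
    DForest.restrict_up_eq_some

theorem DForest.restrict_restrict_iso (F : DForest L V) (S : Finset V) (A : Finset {v // v ∈ S})
    (B : Finset V) (h : ∀ v, v ∈ B ↔ ∃ hv : v ∈ S, (⟨v, hv⟩ : {v // v ∈ S}) ∈ A) :
    ((F.restrict S).restrict A).Iso (F.restrict B) := by
  refine DForest.Iso.of_iff
    { toFun := fun a => ⟨a.1.1, (h _).2 ⟨a.1.2, a.2⟩⟩
      invFun := fun b => ⟨⟨b.1, ((h _).1 b.2).1⟩, ((h _).1 b.2).2⟩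
      left_inv := fun _ => rfl
      right_inv := fun _ => rfl } fun v w l => ?_
  simp only [DForest.restrict_up_eq_some, Equiv.coe_fn_mk]

/-! ### The leaf deletion operator -/

theorem linExt_basisVec {M : Type*} [AddCommMonoid M] [Module ℝ M] (f : ForestClass L → M)
    (x : ForestClass L) : linExt f (basisVec x) = f x := by
  rw [linExt, basisVec, ← MonoidAlgebra.basis_apply, Module.Basis.constr_basis]

theorem ck_hom_ext {M : Type*} [AddCommMonoid M] [Module ℝ M] {f g : CK L →ₗ[ℝ] M}
    (h : ∀ x, f (basisVec x) = g (basisVec x)) : f = g :=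
  (MonoidAlgebra.basis (ForestClass L) ℝ).ext fun x => by
    rw [MonoidAlgebra.basis_apply]; exact h x

theorem basisVec_mul (x y : ForestClass L) :
    (basisVec (x * y) : CK L) = basisVec x * basisVec y := by
  simp [basisVec, MonoidAlgebra.single_mul_single]

theorem basisVec_one : (basisVec 1 : CK L) = 1 := rfl

theorem basisVec_pow (x : ForestClass L) (k : ℕ) : (basisVec (x ^ k) : CK L) = basisVec x ^ k := by
  induction k with
  | zero => simp [basisVec_one]
  | succ k ih => rw [pow_succ, pow_succ, basisVec_mul, ih]

open Classical in
theorem basisVec_coeff (x y : ForestClass L) :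
    (basisVec x : CK L).coeff y = if x = y then 1 else 0 := by
  rw [basisVec, MonoidAlgebra.coeff_single, Finsupp.single_apply]

theorem basisVec_injective : Function.Injective (basisVec : ForestClass L → CK L) := by
  intro x y h
  by_contra hne
  have := basisVec_coeff x y
  rw [h, basisVec_coeff] at this
  simp [hne] at this

theorem coproduct_toClass [Fintype V] (F : DForest L V) :
    coproduct L (basisVec F.toClass) = forestCoproduct F := by
  refine (linExt_basisVec _ _).trans ?_
  exact forestCoproduct_congr (F.iso_transport _).symm

/-- The operator that sends a forest to the sum of the forests with one leaf deleted. -/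
def leafDel (L : Type*) : CK L →ₗ[ℝ] CK L :=
  (TensorProduct.lid ℝ (CK L)).toLinearMap ∘ₗ
    TensorProduct.map (linExt fun x => if x.degree = 1 then (1 : ℝ) else 0) LinearMap.id ∘ₗ
      coproduct L

theorem eq_bullet_of_degree {x : ForestClass L} (hx : x.degree = 1) : x = ForestClass.bullet L := by
  induction x using ForestClass.ind with | _ n F
  rw [ForestClass.degree_toClass, Fintype.card_fin] at hx
  subst hx
  rw [ForestClass.bullet, DForest.toClass_eq_iff]
  refine DForest.Iso.of_iff (Equiv.refl _) fun v w l => ?_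
  simp only [DForest.discrete, Equiv.refl_apply, reduceCtorEq, iff_false]
  intro h
  obtain rfl := Subsingleton.elim v w
  exact F.not_isParent_self _ ⟨l, h⟩

theorem proj_basisVec (d : ℕ) (x : ForestClass L) :
    proj L d (basisVec x) = if x.degree = d then basisVec x else 0 := by
  rw [proj, linExt_basisVec]

theorem counit_basisVec [DecidableEq (ForestClass L)] (x : ForestClass L) :
    counit L (basisVec x) = if x = 1 then 1 else 0 := by
  rw [counit, linExt_basisVec]
  congr

theorem eq_one_of_degree {x : ForestClass L} (hx : x.degree = 0) : x = 1 := by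
  induction x using ForestClass.ind with | _ n F
  rw [ForestClass.degree_toClass, Fintype.card_fin] at hx
  subst hx
  exact DForest.toClass_eq_iff.2 (DForest.Iso.of_iff (Equiv.refl _) fun v => v.elim0)

/-- The only forest of degree 1 is •, so the projection of the first tensor factor to degree 1
leaves • ⊗ ∂z. -/
theorem refinedCoproduct_one_cons (D : List ℕ) (z : CK L) :
    refinedCoproduct L (1 :: D) z =
      TensorAlgebra.ι ℝ (basisVec (ForestClass.bullet L)) * refinedCoproduct L D (leafDel L z) := by
  have h : LinearMap.mul' ℝ (TensorAlgebra ℝ (CK L)) ∘ₗ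
      TensorProduct.map (TensorAlgebra.ι ℝ ∘ₗ proj L 1) (refinedCoproduct L D) =
      LinearMap.mulLeft ℝ (TensorAlgebra.ι ℝ (basisVec (ForestClass.bullet L))) ∘ₗ
        refinedCoproduct L D ∘ₗ (TensorProduct.lid ℝ (CK L)).toLinearMap ∘ₗ
        TensorProduct.map (linExt fun x => if x.degree = 1 then (1 : ℝ) else 0) LinearMap.id := by
    refine TensorProduct.ext (ck_hom_ext fun x => LinearMap.ext fun w => ?_)
    simp only [LinearMap.compr₂ₛₗ_apply, TensorProduct.mk_apply,
      LinearMap.comp_apply,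
      TensorProduct.map_tmul, LinearMap.mul'_apply, proj_basisVec, linExt_basisVec,
      LinearEquiv.coe_coe, TensorProduct.lid_tmul, LinearMap.mulLeft_apply, LinearMap.id_apply]
    split_ifs with hx
    · rw [eq_bullet_of_degree hx, one_smul]
    · simp
  exact LinearMap.congr_fun h (coproduct L z)

theorem descentOp_one_cons (D : List ℕ) (z : CK L) :
    descentOp L (1 :: D) z = basisVec (ForestClass.bullet L) * descentOp L D (leafDel L z) := by
  rw [descentOp, LinearMap.comp_apply, refinedCoproduct_one_cons]
  simp [multiProduct, descentOp]

theorem descentOp_replicate_append (r : ℕ) (D : List ℕ) (z : CK L) :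
    descentOp L (List.replicate r 1 ++ D) z =
      basisVec (ForestClass.bullet L) ^ r * descentOp L D ((leafDel L)^[r] z) := by
  induction r generalizing z with
  | zero => simp
  | succ r ih =>
    rw [List.replicate_succ, List.cons_append, descentOp_one_cons, ih, pow_succ',
      Function.iterate_succ_apply, mul_assoc]

/-- The counit on the remaining trunk kills every cut except the one that removes all vertices. -/
theorem descentOp_singleton (d : ℕ) (z : CK L) : descentOp L [d] z = proj L d z := by
  classical
  suffices h : descentOp L [d] = proj L d by rw [h]
  refine ck_hom_ext fun x => ?_
  induction x using ForestClass.ind with | _ n F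
  simp only [descentOp, LinearMap.comp_apply, refinedCoproduct, coproduct_toClass, forestCoproduct,
    map_sum, TensorProduct.map_tmul, LinearMap.mul'_apply, counit_basisVec]
  rw [Finset.sum_eq_single Finset.univ]
  · rw [if_pos (eq_one_of_degree (by simp [ForestClass.degree_toClass])),
      DForest.toClass_eq_iff.2 (DForest.restrict_univ_iso F)]
    simp [multiProduct]
  · intro U _ hU
    rw [if_neg]
    · simp
    · intro h
      have := congrArg ForestClass.degree h
      rw [ForestClass.degree_toClass, Fintype.card_coe] at this
      rw [show (1 : ForestClass L).degree = 0 from rfl] at this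
      exact hU ((@Finset.compl_eq_empty_iff _ _ (_) U).1 (Finset.card_eq_zero.1 this))
  · simp

/-- Each split-off • contributes the coefficient 1, so only the repeated leaf deletion is left. -/
theorem sumCoeff_refinedCoproduct_replicate (r : ℕ) (z : CK L) :
    sumCoeff L (refinedCoproduct L (List.replicate r 1) z) = counit L ((leafDel L)^[r] z) := by
  induction r generalizing z with
  | zero => simp [refinedCoproduct, sumCoeff]
  | succ r ih =>
    rw [List.replicate_succ, refinedCoproduct_one_cons, map_mul, ih, Function.iterate_succ_apply]
    simp [sumCoeff, linExt_basisVec]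

theorem eta_eq (x : ForestClass L) :
    eta x = counit L ((leafDel L)^[x.degree] (basisVec x)) :=
  sumCoeff_refinedCoproduct_replicate _ _

/-- The degree functional keeps the one-element cuts, and {v} is closed under taking children
exactly when v is a leaf. -/
theorem leafDel_toClass [Fintype V] [DecidableEq V] (F : DForest L V) :
    leafDel L (basisVec F.toClass) =
      ∑ v ∈ leaves F Finset.univ, basisVec (F.restrict {v}ᶜ).toClass := by
  classical
  simp only [leafDel, LinearMap.comp_apply, coproduct_toClass, forestCoproduct, map_sum,
    TensorProduct.map_tmul, linExt_basisVec, LinearMap.id_apply, LinearEquiv.coe_coe,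
    TensorProduct.lid_tmul, ForestClass.degree_toClass, Fintype.card_coe, ite_smul, one_smul,
    zero_smul]
  rw [← Finset.sum_filter, Finset.filter_filter]
  trans ∑ U ∈ (leaves F Finset.univ).image fun v => {v}, basisVec (F.restrict Uᶜ).toClass
  · refine Finset.sum_congr ?_ fun U _ => by congr!
    ext U
    simp only [Finset.mem_filter, Finset.mem_univ, true_and, Finset.mem_image, mem_leaves,
      Finset.card_eq_one]
    constructor
    · rintro ⟨h, v, rfl⟩
      refine ⟨v, fun w _ hw => ?_, rfl⟩
      have := h v w hw (by simp)
      rw [Finset.mem_singleton] at this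
      exact F.not_isParent_self v (this ▸ hw)
    · rintro ⟨v, h, rfl⟩
      refine ⟨fun w u hwu hw => ?_, v, rfl⟩
      rw [Finset.mem_singleton] at hw
      exact absurd (hw ▸ hwu) (h u trivial)
  · rw [Finset.sum_image (by intro a _ b _ h; simpa using h)]

theorem leafDel_restrict [DecidableEq V] (F : DForest L V) (S : Finset V) :
    leafDel L (basisVec (F.restrict S).toClass) =
      ∑ u ∈ leaves F S, basisVec (F.restrict (S.erase u)).toClass := by
  rw [leafDel_toClass]
  refine Finset.sum_bij (fun v _ => v.1) ?_ ?_ ?_ ?_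
  · rintro v hv
    simp only [mem_leaves, Finset.mem_univ, true_and, true_imp_iff,
      DForest.isParent_restrict] at hv ⊢
    exact ⟨v.2, fun w hw => hv ⟨w, hw⟩⟩
  · intro a _ b _ h
    exact Subtype.ext h
  · intro b hb
    rw [mem_leaves] at hb
    refine ⟨⟨b, hb.1⟩, ?_, rfl⟩
    simp only [mem_leaves, Finset.mem_univ, true_and, true_imp_iff, DForest.isParent_restrict]
    exact fun w => hb.2 _ w.2
  · intro v _
    congr 1
    rw [DForest.toClass_eq_iff]
    refine DForest.restrict_restrict_iso F S _ _ fun w => ?_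
    simp [Subtype.ext_iff, and_comm]

theorem card_erase_of_mem_leaves [DecidableEq V] {F : DForest L V} {S : Finset V} {u : V}
    (hu : u ∈ leaves F S) : (S.erase u).card + 1 = S.card :=
  Finset.card_erase_add_one (mem_leaves.1 hu).1

theorem leafDel_iterate_succ_restrict [DecidableEq V] (F : DForest L V) (S : Finset V) (r : ℕ) :
    (leafDel L)^[r + 1] (basisVec (F.restrict S).toClass) =
      ∑ u ∈ leaves F S, (leafDel L)^[r] (basisVec (F.restrict (S.erase u)).toClass) := by
  rw [Function.iterate_succ_apply, leafDel_restrict, ← Module.End.coe_pow, map_sum]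

/-- Each deletion lowers the degree by one, so the last projection in Δ_{1^r,n-r} is automatic. If
`r` exceeds `S.card`, both sides are 0. -/
theorem proj_leafDel_iterate_restrict (F : DForest L V) (S : Finset V) (r : ℕ) :
    proj L (S.card - r) ((leafDel L)^[r] (basisVec (F.restrict S).toClass)) =
      (leafDel L)^[r] (basisVec (F.restrict S).toClass) := by
  classical
  induction r generalizing S with
  | zero => simp [proj_basisVec, ForestClass.degree_toClass]
  | succ r ih =>
    rw [leafDel_iterate_succ_restrict, map_sum]
    refine Finset.sum_congr rfl fun u hu => ?_
    rw [← card_erase_of_mem_leaves hu, Nat.add_sub_add_right, ih]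

theorem leafDel_iterate_restrict_eq_zero (F : DForest L V) (S : Finset V) (r : ℕ)
    (hr : S.card < r) : (leafDel L)^[r] (basisVec (F.restrict S).toClass) = 0 := by
  classical
  induction r generalizing S with
  | zero => omega
  | succ r ih =>
    rw [leafDel_iterate_succ_restrict]
    refine Finset.sum_eq_zero fun u hu => ih _ ?_
    have := card_erase_of_mem_leaves hu
    omega

theorem exists_restrict_univ (x : ForestClass L) :
    ∃ (F : DForest L (Fin x.degree)), (F.restrict Finset.univ).toClass = x := by
  induction x using ForestClass.ind with | _ n F
  exact ⟨F.transport (Fintype.equivFin _), DForest.toClass_eq_iff.2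
    ((DForest.restrict_univ_iso _).trans (F.iso_transport _).symm)⟩

theorem proj_leafDel_iterate (x : ForestClass L) (r : ℕ) :
    proj L (x.degree - r) ((leafDel L)^[r] (basisVec x)) = (leafDel L)^[r] (basisVec x) := by
  obtain ⟨F, hF⟩ := exists_restrict_univ x
  have := proj_leafDel_iterate_restrict F Finset.univ r
  rwa [hF, Finset.card_univ, Fintype.card_fin] at this

theorem leafDel_iterate_eq_zero (x : ForestClass L) (r : ℕ) (hr : x.degree < r) :
    (leafDel L)^[r] (basisVec x) = 0 := by
  obtain ⟨F, hF⟩ := exists_restrict_univ x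
  have := leafDel_iterate_restrict_eq_zero F Finset.univ r (by simpa using hr)
  rwa [hF] at this

theorem descentOp_replicate_append_sub (x : ForestClass L) (r : ℕ) :
    descentOp L (List.replicate r 1 ++ [x.degree - r]) (basisVec x) =
      basisVec (ForestClass.bullet L) ^ r * (leafDel L)^[r] (basisVec x) := by
  rw [descentOp_replicate_append, descentOp_singleton, proj_leafDel_iterate]

/-! ### Multiplication by a one-vertex forest -/

theorem DForest.sum_up_inr_inr {F : DForest L V} {G : DForest L W} {v w : W} {l : L} :
    (F.sum G).up (Sum.inr v) = some (Sum.inr w, l) ↔ G.up v = some (w, l) := by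
  simp only [DForest.sum, Sum.elim_inr, Option.map_eq_some_iff]
  constructor
  · rintro ⟨⟨a, m⟩, ha, hb⟩
    simp only [Prod.map_apply, id, Prod.mk.injEq, Sum.inr.injEq] at hb
    rw [ha, hb.1, hb.2]
  · intro h
    exact ⟨_, h, rfl⟩

theorem DForest.sum_up_inr_inl {F : DForest L V} {G : DForest L W} {v : W} {a : V} {l : L} :
    (F.sum G).up (Sum.inr v) ≠ some (Sum.inl a, l) := by
  simp [DForest.sum, Option.map_eq_some_iff]

/-- The leaves of • ⨿ x are • itself and the leaves of x. As operators, ∂b = 1 + b∂. -/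
theorem leafDel_bullet_mul (z : CK L) :
    leafDel L (basisVec (ForestClass.bullet L) * z) =
      z + basisVec (ForestClass.bullet L) * leafDel L z := by
  classical
  suffices h : leafDel L ∘ₗ LinearMap.mulLeft ℝ (basisVec (ForestClass.bullet L)) =
      LinearMap.id + LinearMap.mulLeft ℝ (basisVec (ForestClass.bullet L)) ∘ₗ leafDel L from
    LinearMap.congr_fun h z
  refine ck_hom_ext fun x => ?_
  induction x using ForestClass.ind with | _ n F
  simp only [LinearMap.comp_apply, LinearMap.mulLeft_apply, LinearMap.add_apply, LinearMap.id_apply]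
  rw [← basisVec_mul, ForestClass.bullet, ForestClass.toClass_mul_toClass, leafDel_toClass,
    leafDel_toClass, Finset.mul_sum]
  set G := (DForest.discrete L (Fin 1)).sum F
  have up_inl : ∀ a, G.up (Sum.inl a) = none := fun a => rfl
  have up_inr : ∀ v w l, G.up (Sum.inr v) = some (Sum.inr w, l) ↔ F.up v = some (w, l) :=
    fun _ _ _ => DForest.sum_up_inr_inr
  have up_inr_inl : ∀ v a l, G.up (Sum.inr v) ≠ some (Sum.inl a, l) :=
    fun _ _ _ => DForest.sum_up_inr_inl
  have hl : leaves G Finset.univ =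
      insert (Sum.inl 0) ((leaves F Finset.univ).map Function.Embedding.inr) := by
    ext v
    simp only [mem_leaves, Finset.mem_univ, true_and, true_imp_iff, Finset.mem_insert,
      Finset.mem_map, Function.Embedding.inr_apply]
    rcases v with a | v
    · obtain rfl := Subsingleton.elim a 0
      simp only [true_or, iff_true]
      rintro (b | w) ⟨l, h⟩
      · simp [up_inl] at h
      · exact up_inr_inl _ _ _ h
    · simp only [reduceCtorEq, false_or, Sum.inr.injEq, exists_eq_right]
      constructor
      · rintro h w ⟨l, hw⟩
        exact h (Sum.inr w) ⟨l, (up_inr _ _ _).2 hw⟩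
      · rintro h (b | w) ⟨l, hw⟩
        · simp [up_inl] at hw
        · exact h w ⟨l, (up_inr _ _ _).1 hw⟩
  rw [hl, Finset.sum_insert (by simp), Finset.sum_map]
  congr 1
  · congr 1
    rw [DForest.toClass_eq_iff]
    -- Deleting the added vertex leaves a copy of `F`.
    refine DForest.Iso.symm (DForest.Iso.of_iff (Equiv.ofBijective
      (fun v => ⟨Sum.inr v, by simp⟩) ⟨?_, ?_⟩) ?_)
    · intro a b h
      simpa using h
    · rintro ⟨a | v, h⟩
      · exact absurd (Subsingleton.elim a 0) (by simpa using h)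
      · exact ⟨v, rfl⟩
    · intro v w l
      rw [DForest.restrict_up_eq_some]
      exact (up_inr _ _ _).symm
  · refine Finset.sum_congr rfl fun v _ => ?_
    rw [← basisVec_mul, ForestClass.toClass_mul_toClass]
    congr 1
    rw [DForest.toClass_eq_iff]
    -- Deleting a leaf of `F` commutes with adding the isolated vertex; `g` is the bijection of the
    -- remaining vertices.
    let g : Fin 1 ⊕ {w // w ∈ ({v}ᶜ : Finset (Fin n))} →
        {w // w ∈ ({Function.Embedding.inr v}ᶜ : Finset (Fin 1 ⊕ Fin n))} := fun x =>
      ⟨x.map id Subtype.val, by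
        rcases x with a | ⟨w, hw⟩
        · simp
        · rw [Finset.mem_compl, Finset.mem_singleton] at hw ⊢
          intro h
          exact hw (Sum.inr.inj h)⟩
    refine DForest.Iso.symm (DForest.Iso.of_iff (Equiv.ofBijective g ⟨?_, ?_⟩) ?_)
    · intro a b h
      exact Sum.map_injective.2 ⟨Function.injective_id, Subtype.val_injective⟩
        (congrArg Subtype.val h)
    · rintro ⟨a | w, h⟩
      · exact ⟨Sum.inl a, rfl⟩
      · refine ⟨Sum.inr ⟨w, ?_⟩, rfl⟩
        rw [Finset.mem_compl, Finset.mem_singleton] at h ⊢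
        exact fun hw => h (congrArg Sum.inr hw)
    · intro x y l
      rw [DForest.restrict_up_eq_some]
      change _ ↔ G.up (x.map id Subtype.val) = some (y.map id Subtype.val, l)
      rcases x with a | a
      · exact iff_of_false (by simp [DForest.sum, DForest.discrete])
          (by simp [up_inl])
      · rcases y with b | b
        · exact iff_of_false DForest.sum_up_inr_inl (up_inr_inl _ _ _)
        · exact DForest.sum_up_inr_inr.trans
            (DForest.restrict_up_eq_some.trans (up_inr a.1 b.1 l).symm)

/-- The commutator of ∂^(r+1) and b is (r+1)∂^r, as for differentiation and multiplication by a
variable. -/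
theorem leafDel_iterate_succ_bullet_mul (r : ℕ) (z : CK L) :
    (leafDel L)^[r + 1] (basisVec (ForestClass.bullet L) * z) =
      ((r : ℝ) + 1) • (leafDel L)^[r] z +
        basisVec (ForestClass.bullet L) * (leafDel L)^[r + 1] z := by
  induction r with
  | zero => simp [leafDel_bullet_mul]
  | succ r ih =>
    rw [Function.iterate_succ_apply', ih, map_add, map_smul, leafDel_bullet_mul,
      ← Function.iterate_succ_apply' (leafDel L), ← Function.iterate_succ_apply' (leafDel L),
      ← add_assoc]
    congr 1
    push_cast
    module

/-! ### The rescaling function η -/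

theorem eta_bullet_mul (x : ForestClass L) :
    eta (ForestClass.bullet L * x) = ((x.degree : ℝ) + 1) * eta x := by
  have h : (ForestClass.bullet L * x).degree = x.degree + 1 := by
    rw [ForestClass.degree_mul, add_comm]; rfl
  rw [eta_eq, eta_eq, h, basisVec_mul, leafDel_iterate_succ_bullet_mul,
    leafDel_iterate_eq_zero x _ (Nat.lt_succ_self _)]
  simp

/-- An isolated vertex can be removed at any moment of the dismantling, so each new one multiplies η
by the new degree. -/
theorem eta_bullet_pow_mul (k : ℕ) (x : ForestClass L) :
    eta (ForestClass.bullet L ^ k * x) * (x.degree.factorial : ℝ) =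
      ((x.degree + k).factorial : ℝ) * eta x := by
  induction k with
  | zero => simp [mul_comm]
  | succ k ih =>
    rw [pow_succ', mul_assoc, eta_bullet_mul, ForestClass.degree_mul,
      ForestClass.degree_bullet_pow, mul_assoc, ih, ← add_assoc, Nat.factorial_succ]
    push_cast
    ring

theorem eta_restrict [DecidableEq V] (F : DForest L V) (S : Finset V) (hS : S.Nonempty) :
    eta (F.restrict S).toClass = ∑ u ∈ leaves F S, eta (F.restrict (S.erase u)).toClass := by
  simp only [eta_eq, ForestClass.degree_toClass, Fintype.card_coe]
  obtain ⟨n, hn⟩ := Nat.exists_eq_add_of_lt (Finset.card_pos.2 hS)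
  rw [zero_add] at hn
  rw [hn, leafDel_iterate_succ_restrict, map_sum]
  refine Finset.sum_congr rfl fun u hu => ?_
  have := card_erase_of_mem_leaves hu
  rw [show (S.erase u).card = n by omega]

theorem eta_restrict_empty (F : DForest L V) : eta (F.restrict ∅).toClass = 1 := by
  classical
  rw [eta_eq, ForestClass.degree_toClass, Fintype.card_coe, Finset.card_empty,
    Function.iterate_zero_apply, counit_basisVec, if_pos]
  exact eq_one_of_degree (by simp [ForestClass.degree_toClass])

/-- Without a leaf one could descend inside `S` for ever. The vertices of a descending chain are
distinct, so a chain of `S.card + 1` of them is impossible. -/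
theorem exists_mem_leaves (F : DForest L V) (S : Finset V) (hS : S.Nonempty) :
    ∃ u, u ∈ leaves F S := by
  by_contra! h
  have key : ∀ n : ℕ, ∃ f : Fin (n + 1) → V, (∀ i, f i ∈ S) ∧
      ∀ i j, i < j → F.Below (f j) (f i) := by
    intro n
    induction n with
    | zero =>
      obtain ⟨v, hv⟩ := hS
      exact ⟨fun _ => v, fun _ => hv, fun i j hij => by omega⟩
    | succ n ih =>
      obtain ⟨f, hf, hb⟩ := ih
      have hl := h (f (Fin.last n))
      rw [mem_leaves] at hl
      push Not at hl
      obtain ⟨w, hw, hp⟩ := hl (hf _)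
      refine ⟨Fin.snoc f w, fun i => ?_, fun i j hij => ?_⟩
      · refine Fin.lastCases ?_ (fun i => ?_) i
        · simpa using hw
        · simpa using hf i
      · revert hij
        refine Fin.lastCases ?_ (fun j => ?_) j
        · refine Fin.lastCases ?_ (fun i => ?_) i
          · simp
          · intro _
            simp only [Fin.snoc_last, Fin.snoc_castSucc]
            rcases eq_or_lt_of_le (Fin.le_last i) with rfl | hi
            · exact Relation.TransGen.single hp
            · exact Relation.TransGen.tail (hb _ _ hi) hp
        · refine Fin.lastCases ?_ (fun i => ?_) i
          · intro h
            exact absurd h (not_lt.2 (Fin.castSucc_lt_last j).le)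
          · intro hij
            simpa using hb i j (by simpa using hij)
  obtain ⟨f, hf, hb⟩ := key S.card
  have hinj : Function.Injective f := by
    intro i j hij
    rcases lt_trichotomy i j with h | h | h
    · exact absurd (hij ▸ hb _ _ h) (F.not_below_self _)
    · exact h
    · exact absurd (hij ▸ hb _ _ h) (F.not_below_self _)
  have := Finset.card_le_card_of_injOn f (s := Finset.univ) (t := S) (fun i _ => hf i)
    hinj.injOn
  simp at this

theorem eta_restrict_pos (F : DForest L V) (S : Finset V) : 0 < eta (F.restrict S).toClass := by
  classical
  induction S using Finset.strongInduction with
  | _ S ih =>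
    rcases S.eq_empty_or_nonempty with rfl | hS
    · rw [eta_restrict_empty]; exact one_pos
    · rw [eta_restrict F S hS]
      refine Finset.sum_pos (fun u hu => ih _ (Finset.erase_ssubset (mem_leaves.1 hu).1))
        (exists_mem_leaves F S hS)

/-- Cancellation of • becomes linear algebra for z, the difference of two basis vectors. Some power
of ∂ kills z; if ∂^(r+1) is the least such power and bz = 0, then the commutator formula reads 0 =
(r+1)∂^r z, a contradiction. -/
theorem bullet_mul_injective :
    Function.Injective fun x : ForestClass L => ForestClass.bullet L * x := by
  intro x y h
  by_contra hne
  replace h : ForestClass.bullet L * x = ForestClass.bullet L * y := h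
  set z : CK L := basisVec x - basisVec y with hz
  have hz0 : z ≠ 0 := sub_ne_zero.2 fun h => hne (basisVec_injective h)
  have hmul : basisVec (ForestClass.bullet L) * z = 0 := by
    rw [hz, mul_sub, ← basisVec_mul, ← basisVec_mul, h, sub_self]
  have hex : ∃ r, (leafDel L)^[r] z = 0 := by
    refine ⟨x.degree + y.degree + 1, ?_⟩
    rw [hz, ← Module.End.coe_pow, map_sub, Module.End.coe_pow,
      leafDel_iterate_eq_zero x _ (by omega), leafDel_iterate_eq_zero y _ (by omega), sub_zero]
  classical
  -- The least exponent is positive because z ≠ 0.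
  obtain ⟨r, hr⟩ : ∃ r, Nat.find hex = r + 1 := by
    refine Nat.exists_eq_succ_of_ne_zero fun h0 => hz0 ?_
    have := Nat.find_spec hex
    rwa [h0] at this
  have h1 : (leafDel L)^[r + 1] z = 0 := hr ▸ Nat.find_spec hex
  have h2 : (leafDel L)^[r] z ≠ 0 := Nat.find_min hex (by omega)
  have h3 := leafDel_iterate_succ_bullet_mul r z
  rw [hmul, h1, mul_zero, add_zero, ← Module.End.coe_pow, map_zero] at h3
  have h4 : (r : ℝ) + 1 ≠ 0 := by positivity
  exact h2 ((smul_eq_zero.1 h3.symm).resolve_left h4)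

/-! ### Ancestors and hook lengths -/

section Hooks

open Classical

variable {L V : Type*} {T : DForest L V}

/-- `u` is `v` or lies below `v`. -/
def DForest.BelowEq (F : DForest L V) (u v : V) : Prop := Relation.ReflTransGen F.IsParent v u

theorem DForest.belowEq_iff {u v : V} : T.BelowEq u v ↔ u = v ∨ T.Below u v :=
  Relation.reflTransGen_iff_eq_or_transGen

theorem DForest.BelowEq.refl (v : V) : T.BelowEq v v := Relation.ReflTransGen.refl

theorem DForest.BelowEq.trans {u v w : V} (h : T.BelowEq u v) (h' : T.BelowEq v w) :
    T.BelowEq u w := Relation.ReflTransGen.trans h' h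

theorem DForest.Below.belowEq {u v : V} (h : T.Below u v) : T.BelowEq u v :=
  Relation.TransGen.to_reflTransGen h

theorem DForest.Below.trans_belowEq {u v w : V} (h : T.Below u v) (h' : T.BelowEq v w) :
    T.Below u w := Relation.TransGen.trans_right h' h

theorem DForest.BelowEq.trans_below {u v w : V} (h : T.BelowEq u v) (h' : T.Below v w) :
    T.Below u w := Relation.TransGen.trans_left h' h

theorem DForest.Below.ne {u v : V} (h : T.Below u v) : u ≠ v := by
  rintro rfl
  exact T.not_below_self _ h

theorem DForest.Below.not_belowEq {u v : V} (h : T.Below u v) : ¬ T.BelowEq v u := fun h' =>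
  T.not_below_self _ (h.trans_belowEq h')

theorem DForest.BelowEq.below_of_ne {u v : V} (h : T.BelowEq u v) (hne : u ≠ v) : T.Below u v :=
  (DForest.belowEq_iff.1 h).resolve_left hne

theorem DForest.IsParent.unique {v w u : V} (h : T.IsParent v u) (h' : T.IsParent w u) :
    v = w := by
  obtain ⟨l, h⟩ := h
  obtain ⟨m, h'⟩ := h'
  rw [h] at h'
  simp only [Option.some.injEq, Prod.mk.injEq] at h'
  exact h'.1

/-- Parents are unique, so the ancestors of a vertex form a chain. -/
theorem DForest.belowEq_total {u a b : V} (ha : T.BelowEq u a) (hb : T.BelowEq u b) :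
    T.BelowEq a b ∨ T.BelowEq b a := by
  have hr : Relator.RightUnique (Function.swap T.IsParent) := fun _ _ _ h h' => h.unique h'
  have := Relation.ReflTransGen.total_of_right_unique hr
    (Relation.reflTransGen_swap.2 ha) (Relation.reflTransGen_swap.2 hb)
  exact this.imp Relation.reflTransGen_swap.1 Relation.reflTransGen_swap.1

theorem DForest.Below.belowEq_parent {c v w : V} (h : T.Below c w) (hp : T.IsParent v c) :
    T.BelowEq v w := by
  obtain ⟨b, hb, hbc⟩ := Relation.TransGen.tail'_iff.1 h
  rwa [hp.unique hbc]

theorem DForest.Below.exists_child {u v : V} (h : T.Below u v) :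
    ∃ c, T.IsParent v c ∧ T.BelowEq u c :=
  Relation.TransGen.head'_iff.1 h

/-- The ancestors of `u` up to `v` are `v` and those up to the child of `v` above `u`. -/
theorem DForest.belowEq_and_belowEq_iff {u c v w : V} (hp : T.IsParent v c) (hc : T.BelowEq u c) :
    T.BelowEq w v ∧ T.BelowEq u w ↔ w = v ∨ T.BelowEq w c ∧ T.BelowEq u w := by
  have hcv : T.Below c v := Relation.TransGen.single hp
  constructor
  · rintro ⟨h1, h2⟩
    by_cases hwv : w = v
    · exact Or.inl hwv
    refine Or.inr ⟨?_, h2⟩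
    rcases DForest.belowEq_total h2 hc with h | h
    · exact h
    · by_cases hwc : c = w
      · exact hwc ▸ DForest.BelowEq.refl _
      · exact absurd ((h.below_of_ne hwc).belowEq_parent hp)
          (h1.below_of_ne hwv).not_belowEq
  · rintro (rfl | ⟨h1, h2⟩)
    · exact ⟨DForest.BelowEq.refl _, hc.trans hcv.belowEq⟩
    · exact ⟨h1.trans hcv.belowEq, h2⟩

/-- `S` contains with a vertex its parent. -/
def ParentClosed (F : DForest L V) (S : Finset V) : Prop :=
  ∀ w v, F.IsParent w v → v ∈ S → w ∈ S

theorem ParentClosed.mem_of_belowEq {S : Finset V} (hS : ParentClosed T S) {u v : V}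
    (h : T.BelowEq u v) (hu : u ∈ S) : v ∈ S := by
  induction h using Relation.ReflTransGen.head_induction_on with
  | refl => exact hu
  | head h _ ih => exact hS _ _ h ih

theorem ParentClosed.mem_leaves_iff {S : Finset V} (hS : ParentClosed T S) {v : V} :
    v ∈ leaves T S ↔ v ∈ S ∧ ∀ w ∈ S, ¬ T.Below w v := by
  rw [mem_leaves]
  refine and_congr_right fun _ => ⟨fun h w hw hb => ?_, fun h w hw hb => ?_⟩
  · obtain ⟨c, hc, hwc⟩ := hb.exists_child
    exact h c (hS.mem_of_belowEq hwc hw) hc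
  · exact h w hw (Relation.TransGen.single hb)

theorem ParentClosed.erase {S : Finset V} (hS : ParentClosed T S) {u : V} (hu : u ∈ leaves T S) :
    ParentClosed T (S.erase u) := by
  intro w v hwv hv
  rw [Finset.mem_erase] at hv ⊢
  refine ⟨?_, hS w v hwv hv.2⟩
  rintro rfl
  exact (mem_leaves.1 hu).2 v hv.2 hwv

/-- The hook length of `v` in `S`: the number of vertices of `S` that are `v` or below `v`. -/
def hookLen (F : DForest L V) (S : Finset V) (v : V) : ℕ := {u ∈ S | F.BelowEq u v}.card

/-- The hook length is the induction measure for cascades: it drops whenever the vacancy moves down.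
-/
theorem hookLen_lt {S : Finset V} {w v : V} (hv : v ∈ S) (h : T.Below w v) :
    hookLen T S w < hookLen T S v := by
  refine Finset.card_lt_card ((Finset.ssubset_iff_of_subset ?_).2 ⟨v, ?_, ?_⟩)
  · intro u
    simp only [Finset.mem_filter]
    exact fun hu => ⟨hu.1, hu.2.trans h.belowEq⟩
  · simp [hv, DForest.BelowEq.refl]
  · simp [hv, h.not_belowEq]

theorem hookLen_pos {S : Finset V} {v : V} (hv : v ∈ S) : 0 < hookLen T S v :=
  Finset.card_pos.2 ⟨v, by simp [hv, DForest.BelowEq.refl]⟩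

theorem ParentClosed.hookLen_leaf {S : Finset V} (hS : ParentClosed T S) {u : V}
    (hu : u ∈ leaves T S) : hookLen T S u = 1 := by
  rw [hookLen, Finset.card_eq_one]
  refine ⟨u, ?_⟩
  ext w
  rw [hS.mem_leaves_iff] at hu
  simp only [Finset.mem_filter, Finset.mem_singleton, DForest.belowEq_iff]
  constructor
  · rintro ⟨hw, h | h⟩
    · exact h
    · exact absurd h (hu.2 w hw)
  · rintro rfl
    exact ⟨hu.1, Or.inl rfl⟩

theorem card_filter_below {S : Finset V} {v : V} (hv : v ∈ S) :
    {w ∈ S | T.Below w v}.card + 1 = hookLen T S v := by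
  have : {u ∈ S | T.BelowEq u v} = insert v {w ∈ S | T.Below w v} := by
    ext w
    simp only [Finset.mem_filter, Finset.mem_insert, DForest.belowEq_iff]
    constructor
    · rintro ⟨h, rfl | h'⟩
      · exact Or.inl rfl
      · exact Or.inr ⟨h, h'⟩
    · rintro (rfl | h)
      · exact ⟨hv, Or.inl rfl⟩
      · exact ⟨h.1, Or.inr h.2⟩
  rw [hookLen, this, Finset.card_insert_of_notMem]
  simp [T.not_below_self]

theorem two_le_hookLen {S : Finset V} {u v : V} (hu : u ∈ S) (hv : v ∈ S) (h : T.Below u v) :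
    2 ≤ hookLen T S v :=
  (Nat.succ_le_of_lt (hookLen_pos hu)).trans_lt (hookLen_lt hv h)

theorem hookLen_eq_card {S : Finset V} {r : V} (hr : ∀ v ∈ S, T.BelowEq v r) :
    hookLen T S r = S.card := by
  rw [hookLen, Finset.filter_true_of_mem hr]

theorem hookLen_erase {S : Finset V} {u v : V} (hu : u ∈ S) :
    hookLen T (S.erase u) v + (if T.BelowEq u v then 1 else 0) = hookLen T S v := by
  unfold hookLen
  rw [Finset.filter_erase]
  split_ifs with h
  · exact Finset.card_erase_add_one (by simp [hu, h])
  · rw [Finset.erase_eq_of_notMem (by simp [h]), add_zero]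

/-! ### The hook walk and its end point -/

variable [Fintype V]

/-- The product of `h / (h - 1)` over the hook lengths `h` of the ancestors of `u` up to `v`. -/
def hookProd (F : DForest L V) (S : Finset V) (v u : V) : ℝ :=
  ∏ w with F.BelowEq w v ∧ F.Below u w, (hookLen F S w : ℝ) / (hookLen F S w - 1)

theorem hookProd_self (S : Finset V) (u : V) : hookProd T S u u = 1 := by
  rw [hookProd, Finset.filter_false_of_mem, Finset.prod_empty]
  rintro w - ⟨h1, h2⟩
  exact h2.not_belowEq h1

theorem hookProd_parent (S : Finset V) {u c v : V} (hp : T.IsParent v c) (hc : T.BelowEq u c) :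
    hookProd T S v u = (hookLen T S v : ℝ) / (hookLen T S v - 1) * hookProd T S c u := by
  have hcv : T.Below c v := Relation.TransGen.single hp
  rw [hookProd, hookProd, ← Finset.prod_insert (a := v)
    (f := fun w => (hookLen T S w : ℝ) / (hookLen T S w - 1))]
  · refine Finset.prod_congr ?_ fun _ _ => rfl
    ext w
    simp only [Finset.mem_filter, Finset.mem_univ, true_and, Finset.mem_insert]
    constructor
    · rintro ⟨h1, h2⟩
      exact ((DForest.belowEq_and_belowEq_iff hp hc).1 ⟨h1, h2.belowEq⟩).imp_right
        fun h => ⟨h.1, h2⟩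
    · rintro (rfl | ⟨h1, h2⟩)
      · exact ⟨DForest.BelowEq.refl _, hc.trans_below hcv⟩
      · exact ⟨h1.trans hcv.belowEq, h2⟩
  · simp [hcv.not_belowEq]

/-- The hook walk identity along the ancestors of a leaf. -/
theorem sum_hookProd_div {S : Finset V} (hS : ParentClosed T S) {u v : V} (hu : u ∈ leaves T S)
    (huv : T.BelowEq u v) :
    ∑ w with T.BelowEq w v ∧ T.BelowEq u w, hookProd T S w u / hookLen T S w =
      hookProd T S v u := by
  have huS := (mem_leaves.1 hu).1
  induction huv using Relation.ReflTransGen.head_induction_on with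
  | refl =>
    have : (Finset.univ.filter fun w => T.BelowEq w u ∧ T.BelowEq u w) = {u} := by
      ext w
      simp only [Finset.mem_filter, Finset.mem_univ, true_and, Finset.mem_singleton]
      constructor
      · rintro ⟨h1, h2⟩
        by_contra hne
        exact (h1.below_of_ne hne).not_belowEq h2
      · rintro rfl
        exact ⟨DForest.BelowEq.refl _, DForest.BelowEq.refl _⟩
    rw [this, Finset.sum_singleton, hookProd_self, hS.hookLen_leaf hu]
    simp
  | @head v c hp hc ih =>
    have hcv : T.Below c v := Relation.TransGen.single hp
    have huv : T.Below u v := DForest.BelowEq.trans_below hc hcv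
    have hv : v ∈ S := hS.mem_of_belowEq huv.belowEq huS
    have : (Finset.univ.filter fun w => T.BelowEq w v ∧ T.BelowEq u w) =
        insert v (Finset.univ.filter fun w => T.BelowEq w c ∧ T.BelowEq u w) := by
      ext w
      simp only [Finset.mem_filter, Finset.mem_univ, true_and, Finset.mem_insert]
      exact DForest.belowEq_and_belowEq_iff hp hc
    rw [this, Finset.sum_insert (by simp [hcv.not_belowEq]), ih, hookProd_parent S hp hc]
    -- With P the sum up to `c` and h the hook length of `v`, the claim is P + P/(h-1) = P·h/(h-1).
    -- The hook of `v` contains both `u` and `v`, so h - 1 ≠ 0.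
    have h2 : (2 : ℝ) ≤ hookLen T S v := by exact_mod_cast two_le_hookLen huS hv huv
    have h3 : (hookLen T S v : ℝ) - 1 ≠ 0 := by linarith
    have h4 : (hookLen T S v : ℝ) ≠ 0 := by linarith
    field_simp
    ring

theorem sum_hookProd_div_below {S : Finset V} (hS : ParentClosed T S) {u v : V}
    (hu : u ∈ leaves T S) (huv : T.BelowEq u v) :
    ∑ w with T.Below w v ∧ T.BelowEq u w, hookProd T S w u / hookLen T S w =
      hookProd T S v u - hookProd T S v u / hookLen T S v := by
  rw [eq_sub_iff_add_eq', ← Finset.sum_insert (a := v) (f := fun w => hookProd T S w u / (hookLen T S w : ℝ))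
      (by simp [T.not_below_self])]
  refine Eq.trans ?_ (sum_hookProd_div hS hu huv)
  refine Finset.sum_congr ?_ fun _ _ => rfl
  ext w
  simp only [Finset.mem_filter, Finset.mem_univ, true_and, Finset.mem_insert, DForest.belowEq_iff]
  constructor
  · rintro (rfl | ⟨h1, h2⟩)
    · exact ⟨Or.inl rfl, DForest.belowEq_iff.1 huv⟩
    · exact ⟨Or.inr h1, h2⟩
  · rintro ⟨rfl | h1, h2⟩
    · exact Or.inl rfl
    · exact Or.inr ⟨h1, h2⟩

/-- The expected value of `f (S \ {u})`, where `u` is the end of the hook walk in `S` from `v`. -/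
def hookWalk (F : DForest L V) (S : Finset V) (f : Finset V → ℝ) (v : V) : ℝ :=
  ∑ u ∈ leaves F S with F.BelowEq u v, hookProd F S v u / hookLen F S v * f (S.erase u)

theorem hookWalk_of_mem_leaves {S : Finset V} (hS : ParentClosed T S) (f : Finset V → ℝ) {v : V}
    (hv : v ∈ leaves T S) : hookWalk T S f v = f (S.erase v) := by
  have : (leaves T S).filter (fun u => T.BelowEq u v) = {v} := by
    ext u
    simp only [Finset.mem_filter, Finset.mem_singleton, DForest.belowEq_iff]
    constructor
    · rintro ⟨h, rfl | h'⟩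
      · rfl
      · exact absurd h' ((hS.mem_leaves_iff.1 hv).2 u (mem_leaves.1 h).1)
    · rintro rfl
      exact ⟨hv, Or.inl rfl⟩
  rw [hookWalk, this, Finset.sum_singleton, hookProd_self, hS.hookLen_leaf hv]
  simp

/-- There are h_v - 1 vertices of `S` strictly below `v`, so for non-leaves this is the recursion of
the cascade: the value at `v` is the mean of the values below. After the sums are exchanged, each
leaf contributes a telescoping sum over its ancestors below `v`. -/
theorem sum_hookWalk_below {S : Finset V} (hS : ParentClosed T S) (f : Finset V → ℝ) {v : V}
    (hv : v ∈ S) :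
    ∑ w ∈ S with T.Below w v, hookWalk T S f w = (hookLen T S v - 1) * hookWalk T S f v := by
  unfold hookWalk
  rw [Finset.sum_comm' (t' := (leaves T S).filter fun u => T.BelowEq u v)
    (s' := fun u => Finset.univ.filter fun w => T.Below w v ∧ T.BelowEq u w)]
  · rw [Finset.mul_sum]
    refine Finset.sum_congr rfl fun u hu => ?_
    rw [Finset.mem_filter] at hu
    rw [← Finset.sum_mul, sum_hookProd_div_below hS hu.1 hu.2]
    have : (hookLen T S v : ℝ) ≠ 0 := by exact_mod_cast (hookLen_pos hv).ne'
    field_simp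
  · intro w u
    simp only [Finset.mem_filter, Finset.mem_univ, true_and]
    constructor
    · rintro ⟨⟨-, h1⟩, h2, h3⟩
      exact ⟨⟨h1, h3⟩, h2, (h3.trans_below h1).belowEq⟩
    · rintro ⟨⟨h1, h3⟩, h2, -⟩
      exact ⟨⟨hS.mem_of_belowEq h3 (mem_leaves.1 h2).1, h1⟩, h2, h3⟩

/-- Summing over all starting points lets each leaf collect the telescoping sum over all its
ancestors up to `r`. -/
theorem sum_hookWalk {S : Finset V} (hS : ParentClosed T S) (f : Finset V → ℝ) {r : V}
    (hr : ∀ v ∈ S, T.BelowEq v r) :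
    ∑ v ∈ S, hookWalk T S f v = ∑ u ∈ leaves T S, hookProd T S r u * f (S.erase u) := by
  unfold hookWalk
  rw [Finset.sum_comm' (t' := leaves T S)
    (s' := fun u => Finset.univ.filter fun w => T.BelowEq w r ∧ T.BelowEq u w)]
  · refine Finset.sum_congr rfl fun u hu => ?_
    rw [← Finset.sum_mul, sum_hookProd_div hS hu (hr u (mem_leaves.1 hu).1)]
  · intro w u
    simp only [Finset.mem_filter, Finset.mem_univ, true_and]
    constructor
    · rintro ⟨h1, h2, h3⟩
      exact ⟨⟨hr w h1, h3⟩, h2⟩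
    · rintro ⟨⟨h1, h3⟩, h2⟩
      exact ⟨hS.mem_of_belowEq h3 (mem_leaves.1 h2).1, h2, h3⟩

theorem hookWalk_root {S : Finset V} (f : Finset V → ℝ) {r : V} (hr : ∀ v ∈ S, T.BelowEq v r) :
    hookWalk T S f r = (∑ u ∈ leaves T S, hookProd T S r u * f (S.erase u)) / S.card := by
  rw [hookWalk, Finset.filter_true_of_mem fun u hu => hr u (mem_leaves.1 hu).1,
    hookLen_eq_card hr, Finset.sum_div]
  exact Finset.sum_congr rfl fun u _ => by ring

/-- Removing the leaf `u` lowers the hook length of each proper ancestor by one, keeps the others,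
and drops the factor h_u = 1. The hook product along the path to the root is thus the ratio of the
two products. -/
theorem prod_hookLen_erase {S : Finset V} (hS : ParentClosed T S) {r u : V}
    (hr : ∀ v ∈ S, T.BelowEq v r) (hu : u ∈ leaves T S) :
    ∏ v ∈ S, (hookLen T S v : ℝ) =
      hookProd T S r u * ∏ v ∈ S.erase u, (hookLen T (S.erase u) v : ℝ) := by
  have huS := (mem_leaves.1 hu).1
  rw [← Finset.mul_prod_erase S _ huS, hS.hookLen_leaf hu, Nat.cast_one, one_mul]
  have : hookProd T S r u = ∏ v ∈ S.erase u,
      if T.Below u v then (hookLen T S v : ℝ) / (hookLen T S v - 1) else 1 := by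
    rw [← Finset.prod_filter, hookProd]
    refine Finset.prod_congr ?_ fun _ _ => rfl
    ext w
    simp only [Finset.mem_filter, Finset.mem_univ, true_and, Finset.mem_erase]
    constructor
    · rintro ⟨-, h2⟩
      exact ⟨⟨h2.ne.symm, hS.mem_of_belowEq h2.belowEq huS⟩, h2⟩
    · rintro ⟨⟨-, h1⟩, h2⟩
      exact ⟨hr w h1, h2⟩
  rw [this, ← Finset.prod_mul_distrib]
  refine Finset.prod_congr rfl fun v hv => ?_
  rw [Finset.mem_erase] at hv
  have h1 := hookLen_erase (T := T) (v := v) huS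
  split_ifs with h
  · rw [if_pos h.belowEq] at h1
    have h2 := two_le_hookLen huS hv.2 h
    have h3 : (hookLen T (S.erase u) v : ℝ) = hookLen T S v - 1 := by
      rw [← h1]; simp
    have h4 : (hookLen T S v : ℝ) - 1 ≠ 0 := by
      have : (2 : ℝ) ≤ hookLen T S v := by exact_mod_cast h2
      linarith
    rw [h3]
    field_simp
  · rw [if_neg fun h' => h (h'.below_of_ne hv.1.symm)] at h1
    rw [one_mul, ← h1, add_zero]

end Hooks

/-! ### Expectations -/

section Expectation

variable {α β : Type*}

/-- The expectation of `f` under `p`. -/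
def expect (p : PMF α) (f : α → ℝ) : ℝ := ∑' a, (p a).toReal * f a

theorem expect_congr {p : PMF α} {f g : α → ℝ} (h : ∀ a ∈ p.support, f a = g a) :
    expect p f = expect p g := by
  refine tsum_congr fun a => ?_
  by_cases ha : a ∈ p.support
  · rw [h a ha]
  · rw [(p.apply_eq_zero_iff a).2 ha]
    simp

variable [Finite α] [Finite β]

theorem expect_eq_sum {α : Type*} [Fintype α] (p : PMF α) (f : α → ℝ) :
    expect p f = ∑ a, (p a).toReal * f a := tsum_fintype _

theorem expect_pure (a : α) (f : α → ℝ) : expect (PMF.pure a) f = f a := by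
  classical
  cases nonempty_fintype α
  rw [expect_eq_sum, Finset.sum_eq_single a]
  · simp
  · intro b _ hb
    simp [PMF.pure_apply, hb]
  · simp

theorem expect_bind (p : PMF α) (q : α → PMF β) (f : β → ℝ) :
    expect (p.bind q) f = expect p fun a => expect (q a) f := by
  cases nonempty_fintype α
  cases nonempty_fintype β
  simp only [expect_eq_sum, PMF.bind_apply, tsum_fintype]
  simp_rw [Finset.mul_sum]
  rw [Finset.sum_comm]
  refine Finset.sum_congr rfl fun b _ => ?_
  rw [ENNReal.toReal_sum fun a _ => ENNReal.mul_ne_top (p.apply_ne_top a) ((q a).apply_ne_top b),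
    Finset.sum_mul]
  refine Finset.sum_congr rfl fun a _ => ?_
  rw [ENNReal.toReal_mul, mul_assoc]

theorem expect_map (p : PMF α) (g : α → β) (f : β → ℝ) :
    expect (p.map g) f = expect p (f ∘ g) := by
  rw [← PMF.bind_pure_comp, expect_bind]
  simp only [Function.comp_apply, expect_pure]
  rfl

theorem expect_const_mul (p : PMF α) (c : ℝ) (f : α → ℝ) :
    expect p (fun a => c * f a) = c * expect p f := by
  cases nonempty_fintype α
  simp only [expect_eq_sum, Finset.mul_sum]
  exact Finset.sum_congr rfl fun a _ => by ring

theorem expect_sum {ι : Type*} (p : PMF α) (s : Finset ι) (f : ι → α → ℝ) :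
    expect p (fun a => ∑ i ∈ s, f i a) = ∑ i ∈ s, expect p (f i) := by
  cases nonempty_fintype α
  simp only [expect_eq_sum, Finset.mul_sum]
  exact Finset.sum_comm

theorem expect_one (p : PMF α) : expect p (fun _ => 1) = 1 := by
  cases nonempty_fintype α
  simp only [expect_eq_sum, mul_one]
  rw [← ENNReal.toReal_sum fun a _ => p.apply_ne_top a, ← tsum_fintype (L := .unconditional _),
    p.tsum_coe]
  rfl

/-- Here `α` need not be finite; this is needed for random orders, where the outcomes are lists. -/
theorem expect_uniformOfFinset_bind {α : Type*} (s : Finset α) (hs : s.Nonempty) (q : α → PMF β)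
    (f : β → ℝ) :
    expect ((PMF.uniformOfFinset s hs).bind q) f =
      1 / (s.card : ℝ) * ∑ a ∈ s, expect (q a) f := by
  cases nonempty_fintype β
  simp only [expect_eq_sum]
  rw [Finset.sum_comm, Finset.mul_sum]
  refine Finset.sum_congr rfl fun b _ => ?_
  rw [PMF.bind_apply, tsum_eq_sum (s := s), ENNReal.toReal_sum fun a _ =>
    ENNReal.mul_ne_top (PMF.apply_ne_top _ a) ((q a).apply_ne_top b), Finset.sum_mul,
    Finset.mul_sum]
  · refine Finset.sum_congr rfl fun a ha => ?_
    rw [ENNReal.toReal_mul, PMF.uniformOfFinset_apply_of_mem _ ha]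
    simp [mul_assoc]
  · intro a ha
    rw [PMF.uniformOfFinset_apply_of_notMem _ ha, zero_mul]

end Expectation

/-! ### The cascade of promotions as a hook walk -/

section Cascade

open Classical

variable {L V : Type*} {T : DForest L V}

/-- No two employees hold the same position. -/
def Proper (pos : Staffing V) : Prop := ∀ e e' v, pos e = some v → pos e' = some v → e = e'

theorem filter_below_erase (S : Finset V) (v : V) :
    {w ∈ S.erase v | T.Below w v} = {w ∈ S | T.Below w v} := by
  ext w
  simp only [Finset.mem_filter, Finset.mem_erase]
  exact ⟨fun h => ⟨h.1.2, h.2⟩, fun h => ⟨⟨h.2.ne, h.1⟩, h.2⟩⟩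

theorem proper_startOfMonth (S : Finset V) : Proper (startOfMonth S) := by
  intro a b v ha hb
  unfold startOfMonth at ha hb
  split_ifs at ha hb
  rw [Option.some.inj ha, Option.some.inj hb]

variable [Fintype V]

/-- The employees in the company. -/
def employed (pos : Staffing V) : Finset V := {e | ∃ v, pos e = some v}

theorem mem_employed {pos : Staffing V} {e : V} : e ∈ employed pos ↔ ∃ v, pos e = some v := by
  simp [employed]

theorem mem_filled {pos : Staffing V} {v : V} : v ∈ filled pos ↔ ∃ e, pos e = some v := by
  simp [filled]

theorem Proper.sum_employed {pos : Staffing V} (hp : Proper pos) (g : V → ℝ) :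
    ∑ e ∈ employed pos, (pos e).elim 0 g = ∑ v ∈ filled pos, g v := by
  have key : ∀ e (he : e ∈ employed pos), pos e = some (mem_employed.1 he).choose := fun e he =>
    (mem_employed.1 he).choose_spec
  refine Finset.sum_bij (fun e he => (mem_employed.1 he).choose) ?_ ?_ ?_ ?_
  · intro e he
    exact mem_filled.2 ⟨e, key e he⟩
  · intro e he e' he' hee
    exact hp _ _ _ (key e he) (hee ▸ key e' he')
  · intro v hv
    obtain ⟨e, he⟩ := mem_filled.1 hv
    have hem : e ∈ employed pos := mem_employed.2 ⟨v, he⟩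
    exact ⟨e, hem, Option.some.inj ((key e hem).symm.trans he)⟩
  · intro e he
    exact congrArg (Option.elim · 0 g) (key e he)

theorem Proper.card_filled {pos : Staffing V} (hp : Proper pos) :
    (filled pos).card = (employed pos).card := by
  have h := hp.sum_employed fun _ => 1
  have h' : ∑ e ∈ employed pos, (pos e).elim (0 : ℝ) (fun _ => 1) =
      ∑ e ∈ employed pos, (1 : ℝ) := by
    refine Finset.sum_congr rfl fun e he => ?_
    obtain ⟨v, hv⟩ := mem_employed.1 he
    rw [hv]; rfl
  rw [h'] at h
  simp only [Finset.sum_const, nsmul_eq_mul, mul_one] at h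
  exact_mod_cast h.symm

theorem Proper.sum_subordinates {pos : Staffing V} (hp : Proper pos) (v : V) (g : V → ℝ) :
    ∑ p ∈ subordinates T pos v, g p.2 = ∑ w ∈ filled pos with T.Below w v, g w := by
  refine Finset.sum_bij (fun p _ => p.2) ?_ ?_ ?_ fun _ _ => rfl
  · rintro ⟨e, w⟩ h
    simp only [subordinates, Finset.mem_filter, Finset.mem_univ, true_and] at h
    exact Finset.mem_filter.2 ⟨mem_filled.2 ⟨e, h.1⟩, h.2⟩
  · rintro ⟨e, w⟩ h ⟨e', w'⟩ h' hw
    simp only [subordinates, Finset.mem_filter, Finset.mem_univ, true_and] at h h' hw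
    subst hw
    rw [hp _ _ _ h.1 h'.1]
  · intro w hw
    rw [Finset.mem_filter, mem_filled] at hw
    obtain ⟨⟨e, he⟩, hb⟩ := hw
    exact ⟨(e, w), by simp [subordinates, he, hb], rfl⟩

theorem Proper.card_subordinates {pos : Staffing V} (hp : Proper pos) (v : V) :
    (subordinates T pos v).card = {w ∈ filled pos | T.Below w v}.card := by
  have := hp.sum_subordinates (T := T) v fun _ => 1
  simp only [Finset.sum_const, nsmul_eq_mul, mul_one] at this
  exact_mod_cast this

/-- A promotion only moves the vacancy from `v` to `w`. The set `S` of filled positions plus the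
vacancy stays the same throughout a cascade. -/
theorem Proper.update_some {pos : Staffing V} (hp : Proper pos) {S : Finset V} {v e w : V}
    (hv : v ∈ S) (hf : filled pos = S.erase v) (he : pos e = some w) (hwv : w ≠ v) :
    Proper (Function.update pos e (some v)) ∧
      filled (Function.update pos e (some v)) = S.erase w ∧
      employed (Function.update pos e (some v)) = employed pos := by
  have hnv : ∀ a, pos a ≠ some v := by
    intro a ha
    have : v ∈ filled pos := mem_filled.2 ⟨a, ha⟩
    simp [hf] at this
  refine ⟨?_, ?_, ?_⟩
  · intro a b x ha hb
    by_cases hae : a = e <;> by_cases hbe : b = e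
    · rw [hae, hbe]
    · subst hae
      rw [Function.update_self, Option.some.injEq] at ha
      rw [Function.update_of_ne hbe] at hb
      exact absurd (ha ▸ hb) (hnv _)
    · subst hbe
      rw [Function.update_self, Option.some.injEq] at hb
      rw [Function.update_of_ne hae] at ha
      exact absurd (hb ▸ ha) (hnv _)
    · rw [Function.update_of_ne hae] at ha
      rw [Function.update_of_ne hbe] at hb
      exact hp _ _ _ ha hb
  · ext x
    rw [mem_filled, Finset.mem_erase]
    constructor
    · rintro ⟨a, ha⟩
      by_cases hae : a = e
      · subst hae
        rw [Function.update_self, Option.some.injEq] at ha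
        subst ha
        exact ⟨hwv.symm, hv⟩
      · rw [Function.update_of_ne hae] at ha
        refine ⟨?_, ?_⟩
        · rintro rfl
          exact hae (hp _ _ _ ha he)
        · have : x ∈ filled pos := mem_filled.2 ⟨a, ha⟩
          rw [hf] at this
          exact Finset.mem_of_mem_erase this
    · rintro ⟨hxw, hx⟩
      by_cases hxv : x = v
      · exact ⟨e, by rw [Function.update_self, hxv]⟩
      · have : x ∈ filled pos := by rw [hf]; exact Finset.mem_erase.2 ⟨hxv, hx⟩
        obtain ⟨a, ha⟩ := mem_filled.1 this
        refine ⟨a, ?_⟩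
        rw [Function.update_of_ne, ha]
        rintro rfl
        rw [he, Option.some.injEq] at ha
        exact hxw ha.symm
  · ext a
    rw [mem_employed, mem_employed]
    by_cases hae : a = e
    · subst hae
      simp [he]
    · rw [Function.update_of_ne hae]

theorem Proper.update_none {pos : Staffing V} (hp : Proper pos) {e v : V} (he : pos e = some v) :
    Proper (Function.update pos e none) ∧
      filled (Function.update pos e none) = (filled pos).erase v ∧
      employed (Function.update pos e none) = (employed pos).erase e := by
  refine ⟨?_, ?_, ?_⟩
  · intro a b x ha hb
    by_cases hae : a = e
    · simp [hae] at ha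
    by_cases hbe : b = e
    · simp [hbe] at hb
    rw [Function.update_of_ne hae] at ha
    rw [Function.update_of_ne hbe] at hb
    exact hp _ _ _ ha hb
  · ext x
    rw [mem_filled, Finset.mem_erase, mem_filled]
    constructor
    · rintro ⟨a, ha⟩
      by_cases hae : a = e
      · simp [hae] at ha
      rw [Function.update_of_ne hae] at ha
      refine ⟨?_, a, ha⟩
      rintro rfl
      exact hae (hp _ _ _ ha he)
    · rintro ⟨hx, a, ha⟩
      refine ⟨a, ?_⟩
      rw [Function.update_of_ne, ha]
      rintro rfl
      rw [he, Option.some.injEq] at ha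
      exact hx ha.symm
  · ext a
    rw [mem_employed, Finset.mem_erase, mem_employed]
    by_cases hae : a = e
    · simp [hae]
    · rw [Function.update_of_ne hae]
      simp [hae]

theorem cascade_of_nonempty {pos : Staffing V} {v : V} (h : (subordinates T pos v).Nonempty) :
    cascade T pos v = (PMF.uniformOfFinset _ h).bind fun p =>
      cascade T (Function.update pos p.1 (some v)) p.2 := by
  rw [cascade, dif_pos h, PMF.bindOnSupport_eq_bind]

theorem cascade_of_empty {pos : Staffing V} {v : V} (h : ¬ (subordinates T pos v).Nonempty) :
    cascade T pos v = PMF.pure pos := by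
  rw [cascade, dif_neg h]

theorem subordinates_nonempty_iff {pos : Staffing V} {S : Finset V} (hS : ParentClosed T S)
    {v : V} (hv : v ∈ S) (hf : filled pos = S.erase v) :
    (subordinates T pos v).Nonempty ↔ v ∉ leaves T S := by
  rw [hS.mem_leaves_iff]
  push Not
  constructor
  · rintro ⟨⟨e, w⟩, h⟩ _
    simp only [subordinates, Finset.mem_filter, Finset.mem_univ, true_and] at h
    refine ⟨w, ?_, h.2⟩
    have : w ∈ filled pos := mem_filled.2 ⟨e, h.1⟩
    rw [hf] at this
    exact Finset.mem_of_mem_erase this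
  · intro h
    obtain ⟨w, hw, hb⟩ := h hv
    have : w ∈ filled pos := by
      rw [hf]
      exact Finset.mem_erase.2 ⟨hb.ne, hw⟩
    obtain ⟨e, he⟩ := mem_filled.1 this
    exact ⟨(e, w), by simp [subordinates, he, hb]⟩

/-- The cascade of promotions is the hook walk. -/
theorem expect_cascade {S : Finset V} (hS : ParentClosed T S) (f : Finset V → ℝ) {v : V}
    (hv : v ∈ S) {pos : Staffing V} (hp : Proper pos) (hf : filled pos = S.erase v) :
    expect (cascade T pos v) (fun p => f (filled p)) = hookWalk T S f v := by
  induction hn : hookLen T S v using Nat.strong_induction_on generalizing v pos with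
  | _ n ih =>
    by_cases hl : v ∈ leaves T S
    · rw [cascade_of_empty (by rw [subordinates_nonempty_iff hS hv hf]; exact not_not.2 hl),
        expect_pure, hf, hookWalk_of_mem_leaves hS f hl]
    · have hne := (subordinates_nonempty_iff hS hv hf).2 hl
      rw [cascade_of_nonempty hne, expect_uniformOfFinset_bind]
      have hstep : ∀ p ∈ subordinates T pos v,
          expect (cascade T (Function.update pos p.1 (some v)) p.2) (fun p => f (filled p)) =
            hookWalk T S f p.2 := by
        rintro ⟨e, w⟩ h
        simp only [subordinates, Finset.mem_filter, Finset.mem_univ, true_and] at h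
        have hwS : w ∈ S := by
          have : w ∈ filled pos := mem_filled.2 ⟨e, h.1⟩
          rw [hf] at this
          exact Finset.mem_of_mem_erase this
        obtain ⟨h1, h2, -⟩ := hp.update_some hv hf h.1 h.2.ne
        exact ih _ (hn ▸ hookLen_lt hv h.2) hwS h1 h2 rfl
      -- The mean over the h_v - 1 subordinates is evaluated by `sum_hookWalk_below`, whose factor
      -- h_v - 1 cancels.
      rw [Finset.sum_congr rfl hstep, hp.sum_subordinates v (hookWalk T S f), hf,
        filter_below_erase, sum_hookWalk_below hS f hv, hp.card_subordinates, hf,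
        filter_below_erase]
      have h1 := card_filter_below (T := T) hv
      have h2 : 0 < {w ∈ S | T.Below w v}.card := by
        rw [← Finset.card_pos, hp.card_subordinates, hf, filter_below_erase] at hne
        exact hne
      have h3 : (hookLen T S v : ℝ) - 1 = ({w ∈ S | T.Below w v}.card : ℝ) := by
        rw [← h1]; simp
      have h4 : ({w ∈ S | T.Below w v}.card : ℝ) ≠ 0 := by exact_mod_cast h2.ne'
      rw [h3]
      field_simp

/-- To iterate firings one needs, for every possible outcome, that a cascade dismisses nobody and
that the position left vacant is a leaf. -/
theorem mem_support_cascade {S : Finset V} (hS : ParentClosed T S) {v : V}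
    (hv : v ∈ S) {pos pos' : Staffing V} (hp : Proper pos) (hf : filled pos = S.erase v)
    (h : pos' ∈ (cascade T pos v).support) :
    Proper pos' ∧ employed pos' = employed pos ∧ ∃ u ∈ leaves T S, filled pos' = S.erase u := by
  induction hn : hookLen T S v using Nat.strong_induction_on generalizing v pos with
  | _ n ih =>
    by_cases hl : v ∈ leaves T S
    · rw [cascade_of_empty (by rw [subordinates_nonempty_iff hS hv hf]; exact not_not.2 hl),
        PMF.mem_support_pure_iff] at h
      subst h
      exact ⟨hp, rfl, v, hl, hf⟩
    · have hne := (subordinates_nonempty_iff hS hv hf).2 hl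
      rw [cascade_of_nonempty hne, PMF.mem_support_bind_iff] at h
      obtain ⟨⟨e, w⟩, h', hc⟩ := h
      rw [PMF.mem_support_uniformOfFinset_iff] at h'
      simp only [subordinates, Finset.mem_filter, Finset.mem_univ, true_and] at h'
      have hwS : w ∈ S := by
        have : w ∈ filled pos := mem_filled.2 ⟨e, h'.1⟩
        rw [hf] at this
        exact Finset.mem_of_mem_erase this
      obtain ⟨h1, h2, h3⟩ := hp.update_some hv hf h'.1 h'.2.ne
      have := ih _ (hn ▸ hookLen_lt hv h'.2) hwS h1 h2 hc rfl
      rwa [h3] at this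

theorem filled_startOfMonth (S : Finset V) : filled (startOfMonth S) = S := by
  ext v
  rw [mem_filled]
  constructor
  · rintro ⟨e, he⟩
    unfold startOfMonth at he
    split_ifs at he with h
    rwa [← Option.some.inj he]
  · intro h
    exact ⟨v, if_pos h⟩

theorem employed_startOfMonth (S : Finset V) : employed (startOfMonth S) = S := by
  ext v
  rw [mem_employed]
  unfold startOfMonth
  split_ifs with h <;> simp [h]

/-- The weights sum to 1 because they are the law of a cascade, run from any staffing in which
exactly `v` is vacant. The hook length formula rests on this. -/
theorem hookWalk_one {S : Finset V} (hS : ParentClosed T S) {v : V} (hv : v ∈ S) :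
    hookWalk T S (fun _ => 1) v = 1 := by
  rw [← expect_cascade hS _ hv (proper_startOfMonth (S.erase v)) (filled_startOfMonth _),
    expect_one]

/-- The hook length formula for the number of ways to take a tree apart leaf by leaf. -/
theorem eta_mul_prod_hookLen {r : V} (hr : ∀ v, T.BelowEq v r) {S : Finset V}
    (hS : ParentClosed T S) :
    eta (T.restrict S).toClass * ∏ v ∈ S, (hookLen T S v : ℝ) = S.card.factorial := by
  induction S using Finset.strongInduction with
  | _ S ih =>
    rcases S.eq_empty_or_nonempty with rfl | hne
    · simp [eta_restrict_empty]
    · rw [eta_restrict T S hne, Finset.sum_mul]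
      have hrS : r ∈ S := by
        obtain ⟨v, hv⟩ := hne
        exact hS.mem_of_belowEq (hr v) hv
      -- By induction each leaf contributes (n-1)! times its hook product from the root; by
      -- `hookWalk_one` at the root these products sum to n.
      have hstep : ∀ u ∈ leaves T S, eta (T.restrict (S.erase u)).toClass *
          ∏ v ∈ S, (hookLen T S v : ℝ) =
          (S.card - 1).factorial * (hookProd T S r u * 1) := by
        intro u hu
        have := ih _ (Finset.erase_ssubset (mem_leaves.1 hu).1) (hS.erase hu)
        rw [Finset.card_erase_of_mem (mem_leaves.1 hu).1] at this
        rw [prod_hookLen_erase hS (fun v _ => hr v) hu, ← this]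
        ring
      have h1 := hookWalk_one hS hrS
      have hpos := Finset.card_pos.2 hne
      have h0 : (S.card : ℝ) ≠ 0 := by exact_mod_cast hpos.ne'
      rw [hookWalk_root _ (fun v _ => hr v), div_eq_one_iff_eq h0] at h1
      rw [Finset.sum_congr rfl hstep, ← Finset.mul_sum, h1, mul_comm]
      exact_mod_cast Nat.mul_factorial_pred hpos.ne'

/-- One step of the chain that removes a leaf `u` from `S` with probability `η(S \ u) / η(S)`,
applied to the function `f`. -/
def leafStep (F : DForest L V) (f : Finset V → ℝ) (S : Finset V) : ℝ :=
  ∑ u ∈ leaves F S, eta (F.restrict (S.erase u)).toClass / eta (F.restrict S).toClass *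
    f (S.erase u)

/-- The hook length formula for `S` and for `S.erase u` turns the end-point probability `hookProd T
S r u / n` into η(S∖u)/η(S). -/
theorem hookWalk_root_eq_leafStep {r : V} (hr : ∀ v, T.BelowEq v r) {S : Finset V}
    (hS : ParentClosed T S) (hne : S.Nonempty) (f : Finset V → ℝ) :
    hookWalk T S f r = leafStep T f S := by
  rw [hookWalk_root _ (fun v _ => hr v), leafStep, Finset.sum_div]
  refine Finset.sum_congr rfl fun u hu => ?_
  have huS := (mem_leaves.1 hu).1
  have hpos := Finset.card_pos.2 hne
  have h0 : (S.card : ℝ) ≠ 0 := by exact_mod_cast hpos.ne'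
  have h1 := eta_mul_prod_hookLen hr hS
  have h2 := eta_mul_prod_hookLen hr (hS.erase hu)
  rw [Finset.card_erase_of_mem huS] at h2
  rw [← Nat.mul_factorial_pred hpos.ne', Nat.cast_mul, ← h2,
    prod_hookLen_erase hS (fun v _ => hr v) hu] at h1
  have h3 : ∏ v ∈ S.erase u, (hookLen T (S.erase u) v : ℝ) ≠ 0 :=
    Finset.prod_ne_zero_iff.2 fun v hv => by exact_mod_cast (hookLen_pos hv).ne'
  have h4 := (eta_restrict_pos T S).ne'
  have h5 : eta (T.restrict S).toClass * hookProd T S r u =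
      S.card * eta (T.restrict (S.erase u)).toClass := by
    apply mul_right_cancel₀ h3
    linarith
  rw [div_mul_eq_mul_div, div_eq_div_iff h0 h4]
  linear_combination f (S.erase u) * h5

/-- The walk from the root has the average law of the walks from all vertices. This explains both
the uniform choice of the fired employee and why the boss may be left out of it. -/
theorem sum_hookWalk_eq {r : V} (hr : ∀ v, T.BelowEq v r) {S : Finset V}
    (hS : ParentClosed T S) (hne : S.Nonempty) (f : Finset V → ℝ) :
    ∑ v ∈ S, hookWalk T S f v = S.card * hookWalk T S f r := by
  have h0 : (S.card : ℝ) ≠ 0 := by exact_mod_cast (Finset.card_pos.2 hne).ne'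
  rw [sum_hookWalk hS f (fun v _ => hr v), hookWalk_root f (fun v _ => hr v)]
  field_simp

/-! ### Firing -/

theorem fire_of_one_lt {pos : Staffing V} {e v : V} (he : pos e = some v)
    (h : 1 < (filled pos).card) :
    fire T pos e = cascade T (Function.update pos e none) v := by
  simp only [fire, he, if_pos h]

theorem fire_of_not_one_lt {pos : Staffing V} (e : V) (h : ¬ 1 < (filled pos).card) :
    fire T pos e = PMF.pure pos := by
  unfold fire
  split
  · rfl
  · rw [if_neg h]

theorem fire_of_none {pos : Staffing V} {e : V} (he : pos e = none) :
    fire T pos e = PMF.pure pos := by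
  simp only [fire, he]

theorem expect_fire {pos : Staffing V} (hp : Proper pos) (hS : ParentClosed T (filled pos))
    (h : 1 < (filled pos).card) (f : Finset V → ℝ) {e v : V} (he : pos e = some v) :
    expect (fire T pos e) (fun p => f (filled p)) = hookWalk T (filled pos) f v := by
  obtain ⟨h1, h2, -⟩ := hp.update_none he
  rw [fire_of_one_lt he h, expect_cascade hS f (mem_filled.2 ⟨e, he⟩) h1 h2]

theorem mem_support_fire {pos pos' : Staffing V} (hp : Proper pos)
    (hS : ParentClosed T (filled pos)) (h : 1 < (filled pos).card) {e v : V}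
    (he : pos e = some v) (h' : pos' ∈ (fire T pos e).support) :
    Proper pos' ∧ employed pos' = (employed pos).erase e ∧
      ∃ u ∈ leaves T (filled pos), filled pos' = (filled pos).erase u := by
  obtain ⟨h1, h2, h3⟩ := hp.update_none he
  rw [fire_of_one_lt he h] at h'
  have := mem_support_cascade hS (mem_filled.2 ⟨e, he⟩) h1 h2 h'
  rwa [h3] at this

/-- Firing a uniformly chosen employee removes a leaf with probabilities `η(S \ u) / η(S)`. -/
theorem sum_expect_fire {r : V} (hr : ∀ v, T.BelowEq v r) {pos : Staffing V} (hp : Proper pos)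
    (hS : ParentClosed T (filled pos)) (h : 1 < (filled pos).card) (f : Finset V → ℝ) :
    ∑ e ∈ employed pos, expect (fire T pos e) (fun p => f (filled p)) =
      (filled pos).card * leafStep T f (filled pos) := by
  have hne : (filled pos).Nonempty := Finset.card_pos.1 (by omega)
  rw [← hookWalk_root_eq_leafStep hr hS hne, ← sum_hookWalk_eq hr hS hne,
    ← hp.sum_employed]
  refine Finset.sum_congr rfl fun e he => ?_
  obtain ⟨v, hv⟩ := mem_employed.1 he
  rw [expect_fire hp hS h f hv, hv]
  rfl

end Cascade

/-! ### Ordered selections of distinct employees -/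

section Lists

open Classical

variable {V : Type*}

/-- The lists of `r` distinct elements of `D`. -/
def injLists : ℕ → Finset V → Finset (List V)
  | 0, _ => {[]}
  | r + 1, D => D.biUnion fun e => (injLists r (D.erase e)).image (List.cons e)

theorem mem_injLists {r : ℕ} {D : Finset V} {l : List V} :
    l ∈ injLists r D ↔ l.Nodup ∧ l.length = r ∧ ∀ x ∈ l, x ∈ D := by
  induction r generalizing D l with
  | zero =>
    simp only [injLists, Finset.mem_singleton, List.length_eq_zero_iff]
    constructor
    · rintro rfl
      simp
    · exact fun h => h.2.1
  | succ r ih =>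
    simp only [injLists, Finset.mem_biUnion, Finset.mem_image, ih]
    constructor
    · rintro ⟨e, he, l, ⟨h1, h2, h3⟩, rfl⟩
      refine ⟨List.nodup_cons.2 ⟨fun h => ?_, h1⟩, by simp [h2], ?_⟩
      · exact absurd (h3 e h) (by simp)
      · intro x hx
        rcases List.mem_cons.1 hx with rfl | hx
        · exact he
        · exact Finset.mem_of_mem_erase (h3 x hx)
    · rintro ⟨h1, h2, h3⟩
      cases l with
      | nil => simp at h2
      | cons e l =>
        rw [List.nodup_cons] at h1
        refine ⟨e, h3 e (by simp), l, ⟨h1.2, by simpa using h2, fun x hx => ?_⟩, rfl⟩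
        refine Finset.mem_erase.2 ⟨?_, h3 x (by simp [hx])⟩
        rintro rfl
        exact h1.1 hx

theorem sum_injLists_succ (r : ℕ) (D : Finset V) (g : List V → ℝ) :
    ∑ l ∈ injLists (r + 1) D, g l = ∑ e ∈ D, ∑ l ∈ injLists r (D.erase e), g (e :: l) := by
  rw [injLists, Finset.sum_biUnion]
  · exact Finset.sum_congr rfl fun e _ => Finset.sum_image fun _ _ _ _ h => (List.cons.inj h).2
  · intro a _ b _ hab
    rw [Function.onFun, Finset.disjoint_left]
    intro l ha hb
    obtain ⟨l₁, -, rfl⟩ := Finset.mem_image.1 ha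
    obtain ⟨l₂, -, h⟩ := Finset.mem_image.1 hb
    exact hab (List.cons.inj h).1.symm

theorem mem_permutations_toList {F : Finset V} {l : List V} :
    l ∈ F.toList.permutations.toFinset ↔ l.Nodup ∧ l.toFinset = F := by
  rw [List.mem_toFinset, List.mem_permutations]
  constructor
  · intro h
    refine ⟨h.nodup_iff.2 F.nodup_toList, ?_⟩
    rw [List.toFinset_eq_of_perm _ _ h, Finset.toList_toFinset]
  · rintro ⟨h, rfl⟩
    exact ((List.toFinset_toList h).symm)

theorem card_permutations_toList (F : Finset V) :
    F.toList.permutations.toFinset.card = F.card.factorial := by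
  rw [List.toFinset_card_of_nodup (List.nodup_permutations _ F.nodup_toList),
    List.length_permutations, Finset.length_toList]

/-- A set of size `r` together with an order is a list of `r` distinct elements; in this form the
first fired employee can be split off. -/
theorem sum_powersetCard_permutations (r : ℕ) (D : Finset V) (g : List V → ℝ) :
    ∑ F ∈ D.powersetCard r, ∑ l ∈ F.toList.permutations.toFinset, g l =
      ∑ l ∈ injLists r D, g l := by
  rw [← Finset.sum_fiberwise_of_maps_to (s := injLists r D) (t := D.powersetCard r)
    (g := List.toFinset)]
  · refine Finset.sum_congr rfl fun F hF => Finset.sum_congr ?_ fun _ _ => rfl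
    rw [Finset.mem_powersetCard] at hF
    ext l
    rw [mem_permutations_toList, Finset.mem_filter, mem_injLists]
    constructor
    · rintro ⟨h1, rfl⟩
      refine ⟨⟨h1, ?_, fun x hx => hF.1 (List.mem_toFinset.2 hx)⟩, rfl⟩
      rw [← hF.2, List.toFinset_card_of_nodup h1]
    · exact fun h => ⟨h.1.1, h.2⟩
  · intro l hl
    rw [mem_injLists] at hl
    rw [Finset.mem_powersetCard, List.toFinset_card_of_nodup hl.1]
    exact ⟨fun x hx => hl.2.2 x (List.mem_toFinset.1 hx), hl.2.1⟩

end Lists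

/-! ### Several firings in a row -/

section FireList

open Classical

variable {L V : Type*} {T : DForest L V}

theorem eq_singleton_root {r : V} (hr : ∀ v, T.BelowEq v r) {S : Finset V}
    (hS : ParentClosed T S) (hne : S.Nonempty) (h : ¬ 1 < S.card) : S = {r} := by
  obtain ⟨v, hv⟩ := hne
  have hrS : r ∈ S := hS.mem_of_belowEq (hr v) hv
  refine (Finset.eq_singleton_iff_unique_mem.2 ⟨hrS, fun x hx => ?_⟩)
  exact Finset.card_le_one.1 (not_lt.1 h) x hx r hrS

/-- Here the leaf chain and the model part ways: the chain empties the tree, while a lone boss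
stays. -/
theorem leafStep_singleton (f : Finset V → ℝ) (r : V) : leafStep T f {r} = f ∅ := by
  have hl : leaves T {r} = {r} := by
    ext v
    simp only [mem_leaves, Finset.mem_singleton]
    constructor
    · exact fun h => h.1
    · rintro rfl
      exact ⟨rfl, by rintro w rfl; exact T.not_isParent_self _⟩
  have he : (({r} : Finset V).erase r) = ∅ := by simp
  have h1 : eta (T.restrict {r}).toClass = 1 := by
    rw [eta_restrict T {r} ⟨r, by simp⟩, hl, Finset.sum_singleton, he, eta_restrict_empty]
  rw [leafStep, hl, Finset.sum_singleton, he, h1, eta_restrict_empty]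
  simp

/-- By independence the event is a box, with sides [0, 1-q) for the members of `F` and [1-q, 1] for
the others. -/
theorem underperformProb_eq {q : ℝ} (hq₀ : 0 ≤ q) (hq₁ : q ≤ 1) {S F : Finset V} (hF : F ⊆ S) :
    underperformProb q S F = (1 - q) ^ F.card * q ^ (S.card - F.card) := by
  have hset : {perf : {e // e ∈ S} → ℝ | ∀ e, perf e < 1 - q ↔ (e : V) ∈ F} =
      Set.pi Set.univ fun e : {e // e ∈ S} =>
        if (e : V) ∈ F then Set.Iio (1 - q) else Set.Ici (1 - q) := by
    ext perf
    simp only [Set.mem_ofPred_eq, Set.mem_pi, Set.mem_univ, true_imp_iff]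
    refine forall_congr' fun e => ?_
    split_ifs with h <;> simp [h]
  have h1 : (MeasureTheory.volume.restrict (Set.Icc (0 : ℝ) 1)) (Set.Iio (1 - q)) =
      ENNReal.ofReal (1 - q) := by
    rw [MeasureTheory.Measure.restrict_apply measurableSet_Iio]
    have : Set.Iio (1 - q) ∩ Set.Icc (0 : ℝ) 1 = Set.Ico 0 (1 - q) := by
      ext x
      simp only [Set.mem_inter_iff, Set.mem_Iio, Set.mem_Icc, Set.mem_Ico]
      constructor
      · rintro ⟨h1, h2, -⟩
        exact ⟨h2, h1⟩
      · rintro ⟨h1, h2⟩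
        exact ⟨h2, h1, by linarith⟩
    rw [this, Real.volume_Ico, sub_zero]
  have h2 : (MeasureTheory.volume.restrict (Set.Icc (0 : ℝ) 1)) (Set.Ici (1 - q)) =
      ENNReal.ofReal q := by
    rw [MeasureTheory.Measure.restrict_apply measurableSet_Ici]
    have : Set.Ici (1 - q) ∩ Set.Icc (0 : ℝ) 1 = Set.Icc (1 - q) 1 := by
      ext x
      simp only [Set.mem_inter_iff, Set.mem_Ici, Set.mem_Icc]
      constructor
      · rintro ⟨h1, -, h2⟩
        exact ⟨h1, h2⟩
      · rintro ⟨h1, h2⟩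
        exact ⟨h1, by linarith, h2⟩
    rw [this, Real.volume_Icc, sub_sub_cancel]
  rw [underperformProb, hset, MeasureTheory.measureReal_def, MeasureTheory.Measure.pi_pi,
    ENNReal.toReal_prod]
  have hfac : ∀ e : {e // e ∈ S}, ((MeasureTheory.volume.restrict (Set.Icc (0 : ℝ) 1))
      (if (e : V) ∈ F then Set.Iio (1 - q) else Set.Ici (1 - q))).toReal =
      if (e : V) ∈ F then 1 - q else q := by
    intro e
    split_ifs
    · rw [h1, ENNReal.toReal_ofReal (by linarith)]
    · rw [h2, ENNReal.toReal_ofReal hq₀]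
  rw [Finset.prod_congr rfl fun e _ => hfac e,
    Finset.prod_coe_sort S fun e => if e ∈ F then 1 - q else q, Finset.prod_ite]
  simp only [Finset.prod_const]
  rw [Finset.filter_mem_eq_inter, Finset.inter_eq_right.2 hF, Finset.filter_notMem_eq_sdiff,
    Finset.card_sdiff_of_subset hF]

variable [Fintype V]

/-- Firing `k` distinct employees, chosen uniformly, removes `k` leaves one after the other. -/
theorem sum_expect_fireList {r : V} (hr : ∀ v, T.BelowEq v r) (f : Finset V → ℝ)
    (hf : f ∅ = f {r}) (k : ℕ) {pos : Staffing V} (hp : Proper pos)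
    (hS : ParentClosed T (filled pos)) (hne : (filled pos).Nonempty) :
    ∑ l ∈ injLists k (employed pos), expect (fireList T pos l) (fun p => f (filled p)) =
      ((filled pos).card.descFactorial k : ℝ) * (leafStep T)^[k] f (filled pos) := by
  induction k generalizing pos with
  | zero => simp [injLists, fireList, expect_pure]
  | succ k ih =>
    rw [sum_injLists_succ, Function.iterate_succ_apply']
    simp only [fireList, expect_bind]
    by_cases h : 1 < (filled pos).card
    · obtain ⟨n, hn⟩ : ∃ n, (filled pos).card = n + 1 := ⟨(filled pos).card - 1, by omega⟩
      rw [hn, Nat.succ_descFactorial_succ, Nat.cast_mul, ← hn, mul_comm ((filled pos).card : ℝ),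
        mul_assoc, ← sum_expect_fire hr hp hS h, Finset.mul_sum]
      refine Finset.sum_congr rfl fun e he => ?_
      obtain ⟨v, hv⟩ := mem_employed.1 he
      rw [← expect_sum, ← expect_const_mul]
      refine expect_congr fun pos' hpos' => ?_
      -- Whatever the cascade does, exactly `e` has left, so the rest of the list is an ordered
      -- selection from the new employees. The induction hypothesis applies to the new company,
      -- which is nonempty because there were at least two.
      obtain ⟨h1, h2, u, hu, h3⟩ := mem_support_fire hp hS h hv hpos'
      have h4 := card_erase_of_mem_leaves hu
      rw [← h2, ih h1 (h3 ▸ hS.erase hu) (Finset.card_pos.1 (by rw [h3]; omega)), h3]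
      congr 3
      omega
    -- Only the boss is left. One firing changes nothing, and `hf` reconciles this with `leafStep`;
    -- for longer lists both sides are 0, since one employee gives no two distinct entries.
    · have hs := eq_singleton_root hr hS hne h
      have hcard : (employed pos).card = 1 := by
        rw [← hp.card_filled, hs, Finset.card_singleton]
      obtain ⟨e, he⟩ := Finset.card_eq_one.1 hcard
      rw [he, Finset.sum_singleton, fire_of_not_one_lt e h]
      simp only [expect_pure]
      cases k with
      | zero => simp [injLists, fireList, expect_pure, hs, leafStep_singleton, hf]
      | succ k => simp [injLists, hs]

theorem fire_support_invariant {pos pos' : Staffing V}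
    (hp : Proper pos) (hS : ParentClosed T (filled pos))
    (hne : (filled pos).Nonempty) {e : V} (h : pos' ∈ (fire T pos e).support) :
    Proper pos' ∧ ParentClosed T (filled pos') ∧ (filled pos').Nonempty := by
  by_cases h1 : 1 < (filled pos).card
  · rcases hv : pos e with _ | v
    · rw [fire_of_none hv, PMF.mem_support_pure_iff] at h
      subst h
      exact ⟨hp, hS, hne⟩
    · obtain ⟨h2, -, u, hu, h3⟩ := mem_support_fire hp hS h1 hv h
      have h4 := card_erase_of_mem_leaves hu
      exact ⟨h2, h3 ▸ hS.erase hu, Finset.card_pos.1 (by rw [h3]; omega)⟩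
  · rw [fire_of_not_one_lt e h1, PMF.mem_support_pure_iff] at h
    subst h
    exact ⟨hp, hS, hne⟩

theorem fireList_support_invariant {pos pos' : Staffing V}
    (hp : Proper pos) (hS : ParentClosed T (filled pos))
    (hne : (filled pos).Nonempty) {l : List V} (h : pos' ∈ (fireList T pos l).support) :
    Proper pos' ∧ ParentClosed T (filled pos') ∧ (filled pos').Nonempty := by
  induction l generalizing pos with
  | nil =>
    rw [fireList, PMF.mem_support_pure_iff] at h
    subst h
    exact ⟨hp, hS, hne⟩
  | cons e l ih =>
    rw [fireList, PMF.mem_support_bind_iff] at h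
    obtain ⟨p, h1, h2⟩ := h
    obtain ⟨h3, h4, h5⟩ := fire_support_invariant hp hS hne h1
    exact ih h3 h4 h5 h2

/-! ### The two models -/

theorem sum_map_filled_mul (p : PMF (Staffing V)) (g : Finset V → ℝ) :
    ∑ S' : Finset V, (p.map filled S').toReal * g S' = expect p (fun a => g (filled a)) := by
  rw [← expect_eq_sum, expect_map]
  rfl

theorem sum_uniformFiring_mul (C S : Finset V) (g : Finset V → ℝ) :
    ∑ S', uniformFiring T C S S' * g S' = 1 / (C.card : ℝ) *
      ∑ e ∈ C, expect (fire T (startOfMonth S) e) (fun a => g (filled a)) := by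
  simp only [uniformFiring, Finset.sum_mul]
  rw [Finset.sum_comm, Finset.mul_sum]
  refine Finset.sum_congr rfl fun e _ => ?_
  rw [← sum_map_filled_mul, Finset.mul_sum]
  exact Finset.sum_congr rfl fun S' _ => by ring

/-- The case of lists of length 1, which also covers the company reduced to its boss. -/
theorem sum_uniformFiring_self {r : V} (hr : ∀ v, T.BelowEq v r) {S : Finset V}
    (hS : ParentClosed T S) (hne : S.Nonempty) (g : Finset V → ℝ) (hg : g ∅ = g {r}) :
    ∑ S', uniformFiring T S S S' * g S' = leafStep T g S := by
  have hcard := Finset.card_pos.2 hne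
  have h0 : (S.card : ℝ) ≠ 0 := by exact_mod_cast hcard.ne'
  have h := sum_expect_fireList hr g hg 1 (proper_startOfMonth S)
    (by rwa [filled_startOfMonth]) (by rwa [filled_startOfMonth])
  rw [sum_injLists_succ] at h
  simp only [injLists, Finset.sum_singleton, fireList, expect_bind, expect_pure,
    employed_startOfMonth, filled_startOfMonth, Nat.descFactorial_one,
    Function.iterate_one] at h
  rw [sum_uniformFiring_mul, h]
  field_simp

theorem sum_singleModel_mul {r : V} (hr : ∀ v, T.BelowEq v r) {S : Finset V}
    (hS : ParentClosed T S) (hne : S.Nonempty) (g : Finset V → ℝ) (hg : g ∅ = g {r}) :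
    ∑ S', singleModel T S S' * g S' =
      (S.card : ℝ) / Fintype.card V * leafStep T g S +
        ((Fintype.card V : ℝ) - S.card) / Fintype.card V * g S := by
  simp only [singleModel, Matrix.of_apply, add_mul, Finset.sum_add_distrib]
  rw [← sum_uniformFiring_self hr hS hne g hg, Finset.mul_sum]
  congr 1
  · exact Finset.sum_congr rfl fun S' _ => by ring
  · rw [Finset.sum_eq_single S]
    · simp
    · intro S' _ h
      simp [h]
    · simp

theorem expect_fireSet (pos : Staffing V) (F : Finset V) (f : Staffing V → ℝ) :
    expect (fireSet T pos F) f = 1 / (F.card.factorial : ℝ) *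
      ∑ l ∈ F.toList.permutations.toFinset, expect (fireList T pos l) f := by
  refine (expect_uniformOfFinset_bind _ _ _ _).trans ?_
  rw [card_permutations_toList]

/-- A given set of k employees underperforms with probability (1-q)^k q^(n-k), and each order has
probability 1/k!. Grouping by k leaves the sum over ordered selections. -/
theorem sum_binomialModel_mul {r : V} (hr : ∀ v, T.BelowEq v r) {q : ℝ} (hq₀ : 0 ≤ q)
    (hq₁ : q ≤ 1) {S : Finset V} (hS : ParentClosed T S) (hne : S.Nonempty) (g : Finset V → ℝ)
    (hg : g ∅ = g {r}) :
    ∑ S', binomialModel T q S S' * g S' = ∑ k ∈ Finset.range (S.card + 1),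
      1 / (k.factorial : ℝ) * (1 - q) ^ k * q ^ (S.card - k) *
        ((S.card.descFactorial k : ℝ) * (leafStep T)^[k] g S) := by
  have h1 : ∑ S', binomialModel T q S S' * g S' = ∑ F ∈ S.powerset, underperformProb q S F *
      expect (fireSet T (startOfMonth S) F) (fun a => g (filled a)) := by
    simp only [binomialModel, Matrix.of_apply, Finset.sum_mul]
    rw [Finset.sum_comm]
    refine Finset.sum_congr rfl fun F _ => ?_
    rw [← sum_map_filled_mul, Finset.mul_sum]
    exact Finset.sum_congr rfl fun S' _ => by ring
  rw [h1, Finset.sum_powerset]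
  refine Finset.sum_congr rfl fun k _ => ?_
  have h := sum_expect_fireList hr g hg k (proper_startOfMonth S)
    (by rwa [filled_startOfMonth]) (by rwa [filled_startOfMonth])
  rw [filled_startOfMonth, employed_startOfMonth] at h
  rw [← h, ← sum_powersetCard_permutations, Finset.mul_sum]
  refine Finset.sum_congr rfl fun F hF => ?_
  rw [Finset.mem_powersetCard] at hF
  rw [underperformProb_eq hq₀ hq₁ hF.1, expect_fireSet, hF.2]
  ring

theorem parentClosed_of_map_filled_ne_zero {S S' : Finset V}
    (hS : ParentClosed T S) (hne : S.Nonempty) {l : List V}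
    (h : (fireList T (startOfMonth S) l).map filled S' ≠ 0) :
    ParentClosed T S' ∧ S'.Nonempty := by
  rw [← PMF.mem_support_iff, PMF.mem_support_map_iff] at h
  obtain ⟨pos', h1, rfl⟩ := h
  exact (fireList_support_invariant (proper_startOfMonth S) (by rwa [filled_startOfMonth])
    (by rwa [filled_startOfMonth]) h1).2

theorem parentClosed_of_singleModel_ne_zero {S S' : Finset V}
    (hS : ParentClosed T S) (hne : S.Nonempty) (h : singleModel T S S' ≠ 0) :
    ParentClosed T S' ∧ S'.Nonempty := by
  by_cases hSS : S' = S
  · subst hSS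
    exact ⟨hS, hne⟩
  · simp only [singleModel, Matrix.of_apply, hSS, if_false, mul_zero, add_zero,
      uniformFiring] at h
    obtain ⟨e, -, he⟩ := Finset.exists_ne_zero_of_sum_ne_zero (right_ne_zero_of_mul h)
    refine parentClosed_of_map_filled_ne_zero hS hne (l := [e]) fun h0 => he ?_
    simp only [fireList, PMF.bind_pure] at h0
    rw [h0]
    simp

theorem parentClosed_of_binomialModel_ne_zero {q : ℝ}
    {S S' : Finset V} (hS : ParentClosed T S) (hne : S.Nonempty)
    (h : binomialModel T q S S' ≠ 0) : ParentClosed T S' ∧ S'.Nonempty := by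
  simp only [binomialModel, Matrix.of_apply] at h
  obtain ⟨F, -, hF⟩ := Finset.exists_ne_zero_of_sum_ne_zero h
  have h1 : (fireSet T (startOfMonth S) F).map filled S' ≠ 0 := fun h0 => hF (by rw [h0]; simp)
  rw [← PMF.mem_support_iff, PMF.mem_support_map_iff] at h1
  obtain ⟨pos', h2, h3⟩ := h1
  rw [fireSet, PMF.mem_support_bind_iff] at h2
  obtain ⟨l, -, hl⟩ := h2
  refine parentClosed_of_map_filled_ne_zero hS hne (l := l) ?_
  rw [← PMF.mem_support_iff, PMF.mem_support_map_iff]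
  exact ⟨pos', hl, h3⟩

/-- With at least two employees, the boss may be excluded from the choice of the fired one. -/
theorem uniformFiring_erase_root {r : V} (hr : ∀ v, T.BelowEq v r) {S : Finset V}
    (hS : ParentClosed T S) (h2 : 1 < S.card) (S' : Finset V) :
    uniformFiring T S S S' = uniformFiring T (S.erase r) S S' := by
  have hne : S.Nonempty := Finset.card_pos.1 (by omega)
  have hrS : r ∈ S := by
    obtain ⟨v, hv⟩ := hne
    exact hS.mem_of_belowEq (hr v) hv
  -- The indicator of `S'` recovers a single transition probability from the expectations.
  let g : Finset V → ℝ := fun A => if A = S' then 1 else 0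
  have hfire : ∀ e ∈ S, expect (fire T (startOfMonth S) e) (fun a => g (filled a)) =
      hookWalk T S g e := by
    intro e he
    rw [expect_fire (v := e) (proper_startOfMonth S) (by rwa [filled_startOfMonth])
      (by rwa [filled_startOfMonth]) g (if_pos he), filled_startOfMonth]
  have hU : ∀ C ⊆ S, uniformFiring T C S S' =
      1 / (C.card : ℝ) * ∑ e ∈ C, hookWalk T S g e := by
    intro C hC
    rw [← Finset.sum_congr rfl fun e he => hfire e (hC he), ← sum_uniformFiring_mul]
    simp [g]
  have hsum := sum_hookWalk_eq hr hS hne g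
  have h0 : (S.card : ℝ) ≠ 0 := by positivity
  have h1 : (S.card : ℝ) - 1 ≠ 0 := by
    have : (1 : ℝ) < S.card := by exact_mod_cast h2
    linarith
  -- The total is n times the root term, so dropping the root term leaves n - 1 times it, and the
  -- two means agree.
  rw [hU S subset_rfl, hU _ (Finset.erase_subset _ _), Finset.sum_erase_eq_sub hrS, hsum,
    Finset.card_erase_of_mem hrS, Nat.cast_pred (by omega)]
  field_simp

end FireList

/-! ### The operators on multiples of • -/

section Operators

variable {L : Type*}

/-- The coefficient of a forest, as a linear functional. -/
def coeffHom (y : ForestClass L) : CK L →ₗ[ℝ] ℝ where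
  toFun z := z.coeff y
  map_add' a b := by simp
  map_smul' c a := by simp

/-- With k = n₀ - n, deleting one of the k isolated vertices and adding it back gives the holding
term of the single model. -/
theorem bullet_mul_leafDel (k : ℕ) (z : CK L) :
    basisVec (ForestClass.bullet L) * leafDel L (basisVec (ForestClass.bullet L) ^ k * z) =
      (k : ℝ) • (basisVec (ForestClass.bullet L) ^ k * z) +
        basisVec (ForestClass.bullet L) ^ (k + 1) * leafDel L z := by
  induction k with
  | zero => simp
  | succ k ih =>
    rw [pow_succ', mul_assoc, leafDel_bullet_mul, ih, mul_add, mul_add, mul_smul_comm,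
      pow_succ' _ (k + 1), mul_assoc]
    push_cast
    module

theorem T2R_basisVec (x : ForestClass L) :
    T2R L x.degree (basisVec x) = (1 / (x.degree : ℝ)) •
      (basisVec (ForestClass.bullet L) * leafDel L (basisVec x)) := by
  have h := descentOp_replicate_append_sub x 1
  rw [pow_one, Function.iterate_one] at h
  rw [← h]
  rfl

theorem drivenChain_apply {n : ℕ} (Φ : CK L →ₗ[ℝ] CK L) (x y : Basis L n) :
    drivenChain Φ x y = eta y.1 / eta x.1 * coeffHom y.1 (Φ (basisVec x.1)) := rfl

theorem BinT2R_basisVec (x : ForestClass L) (q : ℝ) :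
    BinT2R L x.degree q (basisVec x) = ∑ r ∈ Finset.range (x.degree + 1),
      (1 / (r.factorial : ℝ) * (1 - q) ^ r * q ^ (x.degree - r)) •
        (basisVec (ForestClass.bullet L) ^ r * (leafDel L)^[r] (basisVec x)) := by
  simp only [BinT2R, LinearMap.sum_apply, LinearMap.smul_apply, descentOp_replicate_append_sub]

theorem degree_bullet_mul (x : ForestClass L) :
    (ForestClass.bullet L * x).degree = x.degree + 1 := by
  rw [ForestClass.degree_mul, add_comm]
  rfl

/-- The commutator formula sends part of the term r + 1 to the term r. There the coefficients of
b^(r+1) ∂^r add up to (1-q) + q = 1 times the coefficient in degree n. -/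
theorem BinT2R_bullet_mul (x : ForestClass L) (q : ℝ) :
    BinT2R L (x.degree + 1) q (basisVec (ForestClass.bullet L * x)) =
      basisVec (ForestClass.bullet L) * BinT2R L x.degree q (basisVec x) := by
  have h := BinT2R_basisVec (ForestClass.bullet L * x) q
  rw [degree_bullet_mul, basisVec_mul] at h
  rw [basisVec_mul, h, BinT2R_basisVec, Finset.sum_range_succ', Finset.mul_sum]
  set b : CK L := basisVec (ForestClass.bullet L)
  set n := x.degree with hn
  set d : ℕ → CK L := fun r => (leafDel L)^[r] (basisVec x) with hd
  have h1 : ∀ r ∈ Finset.range (n + 1),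
      (1 / ((r + 1).factorial : ℝ) * (1 - q) ^ (r + 1) * q ^ (n + 1 - (r + 1))) •
        (b ^ (r + 1) * (leafDel L)^[r + 1] (b * basisVec x)) =
      (1 - q) • (b * (1 / (r.factorial : ℝ) * (1 - q) ^ r * q ^ (n - r)) • (b ^ r * d r)) +
      (1 / ((r + 1).factorial : ℝ) * (1 - q) ^ (r + 1) * q ^ (n + 1 - (r + 1))) •
        (b * (b ^ (r + 1) * d (r + 1))) := by
    intro r _
    rw [leafDel_iterate_succ_bullet_mul, mul_add, smul_add]
    congr 1
    · rw [mul_smul_comm, mul_smul_comm, smul_smul, smul_smul, pow_succ' b, mul_assoc b]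
      congr 1
      have h1 : ((r + 1).factorial : ℝ) = (r + 1) * r.factorial := by
        rw [Nat.factorial_succ]; push_cast; ring
      have h2 : (r.factorial : ℝ) ≠ 0 := by positivity
      have h3 : (r : ℝ) + 1 ≠ 0 := by positivity
      rw [h1, Nat.add_sub_add_right, pow_succ]
      field_simp
    · rw [mul_left_comm]
  rw [Finset.sum_congr rfl h1, Finset.sum_add_distrib, ← Finset.smul_sum, add_assoc]
  have h2 : (∑ r ∈ Finset.range (n + 1),
      (1 / ((r + 1).factorial : ℝ) * (1 - q) ^ (r + 1) * q ^ (n + 1 - (r + 1))) •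
        (b * (b ^ (r + 1) * d (r + 1)))) +
      (1 / ((0 : ℕ).factorial : ℝ) * (1 - q) ^ 0 * q ^ (n + 1 - 0)) •
        (b ^ 0 * (leafDel L)^[0] (b * basisVec x)) =
      ∑ r ∈ Finset.range (n + 1 + 1), (1 / (r.factorial : ℝ) * (1 - q) ^ r * q ^ (n + 1 - r)) •
        (b * (b ^ r * d r)) := by
    rw [Finset.sum_range_succ' _ (n + 1)]
    congr 1
    simp [hd]
  -- Both sums then run over r ≤ n, since `x` has only n vertices to delete.
  have h3 : d (n + 1) = 0 := leafDel_iterate_eq_zero x _ (Nat.lt_succ_self _)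
  rw [h2, Finset.sum_range_succ _ (n + 1), h3, mul_zero, mul_zero, smul_zero, add_zero, Finset.smul_sum,
    ← Finset.sum_add_distrib]
  refine Finset.sum_congr rfl fun r hr => ?_
  rw [Nat.succ_sub (Nat.lt_succ_iff.1 (Finset.mem_range.1 hr)), mul_smul_comm, smul_smul,
    ← add_smul]
  congr 1
  rw [pow_succ]
  ring

theorem BinT2R_bullet_pow_mul (k : ℕ) (x : ForestClass L) (q : ℝ) :
    BinT2R L (k + x.degree) q (basisVec (ForestClass.bullet L ^ k * x)) =
      basisVec (ForestClass.bullet L) ^ k * BinT2R L x.degree q (basisVec x) := by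
  induction k with
  | zero => simp
  | succ k ih =>
    have h : (ForestClass.bullet L ^ k * x).degree = k + x.degree := by
      rw [ForestClass.degree_mul, ForestClass.degree_bullet_pow]
    have := BinT2R_bullet_mul (ForestClass.bullet L ^ k * x) q
    rw [h, ih] at this
    rw [pow_succ', pow_succ', mul_assoc, mul_assoc, ← this, add_right_comm]

end Operators

section States

open Classical

variable {L V : Type*} {T : DForest L V}

/-! ### Rooted subtrees -/

theorem belowEq_root {root : V} (hroot : ∀ v, T.up v = none ↔ v = root) (v : V) :
    T.BelowEq v root := by
  induction v using T.wf.induction with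
  | _ v ih =>
    rcases h : T.up v with _ | ⟨w, l⟩
    · rw [(hroot v).1 h]
      exact DForest.BelowEq.refl _
    · exact Relation.ReflTransGen.tail (ih w ⟨l, h⟩) ⟨l, h⟩

/-- The closure form is the one that survives leaf deletion and is used in all inductions. -/
theorem isRootedSubtree_iff {root : V} (hroot : ∀ v, T.up v = none ↔ v = root) {S : Finset V} :
    IsRootedSubtree T root S ↔ ParentClosed T S ∧ S.Nonempty := by
  constructor
  · rintro ⟨hr, hc⟩
    refine ⟨fun w v hwv hv => ?_, root, hr⟩
    by_contra hw
    have hreach := (SimpleGraph.reachable_iff_reflTransGen _ _).1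
      (hc.preconnected ⟨v, hv⟩ ⟨root, hr⟩)
    -- A path in `S` from `v` cannot climb above `v`, as its parent `w` is missing; the root would
    -- then lie below `v`.
    have key : ∀ b : (S : Set V), Relation.ReflTransGen
        (T.graph.induce (S : Set V)).Adj ⟨v, hv⟩ b → T.BelowEq b.1 v := by
      intro b hb
      induction hb with
      | refl => exact DForest.BelowEq.refl _
      | @tail a b _ hab ih =>
        have hab' : T.IsParent a.1 b.1 ∨ T.IsParent b.1 a.1 := hab
        rcases hab' with h | h
        · exact Relation.ReflTransGen.tail ih h
        · by_cases hav : a.1 = v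
          · rw [hav] at h
            exact absurd (hwv.unique h ▸ b.2) hw
          · exact (ih.below_of_ne hav).belowEq_parent h
    have h1 := key _ hreach
    have h2 : T.Below root w := h1.trans_below (Relation.TransGen.single hwv)
    exact h2.not_belowEq (belowEq_root hroot w)
  · rintro ⟨hS, v, hv⟩
    have hr : root ∈ S := hS.mem_of_belowEq (belowEq_root hroot v) hv
    have key : ∀ x (hx : x ∈ S),
        (T.graph.induce (S : Set V)).Reachable ⟨x, hx⟩ ⟨root, hr⟩ := by
      intro x
      induction x using T.wf.induction with
      | _ x ih =>
        intro hx
        rcases h : T.up x with _ | ⟨w, l⟩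
        · obtain rfl := (hroot x).1 h
          exact SimpleGraph.Reachable.refl _
        · have hw := hS w x ⟨l, h⟩ hx
          refine SimpleGraph.Reachable.trans (SimpleGraph.Adj.reachable ?_) (ih w ⟨l, h⟩ hw)
          exact Or.inr ⟨l, h⟩
    have : Nonempty (S : Set V) := ⟨⟨root, hr⟩⟩
    exact ⟨hr, ⟨fun a b => (key a.1 a.2).trans (key b.1 b.2).symm⟩⟩

theorem restrict_up_eq_none {root : V} (hroot : ∀ v, T.up v = none ↔ v = root) {S : Finset V}
    (hS : ParentClosed T S) {v : {v // v ∈ S}} (h : (T.restrict S).up v = none) :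
    v.1 = root := by
  rcases hv : T.up v.1 with _ | ⟨w, l⟩
  · exact (hroot _).1 hv
  · have hw := hS w v.1 ⟨l, hv⟩ v.2
    have := (DForest.restrict_up_eq_some (F := T) (S := S) (v := v) (w := ⟨w, hw⟩) (l := l)).2 hv
    rw [h] at this
    simp at this

/-- An isomorphism keeps the label of a non-root vertex, and a label that occurs once in `T` forces
the vertex to be fixed. -/
theorem subset_of_restrict_iso {root : V} (hroot : ∀ v, T.up v = none ↔ v = root)
    (hlab : ∀ v w a b l, T.up v = some (a, l) → T.up w = some (b, l) → v = w)
    {S S' : Finset V} (hS : ParentClosed T S) (hr : root ∈ S')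
    (h : (T.restrict S).Iso (T.restrict S')) : S ⊆ S' := by
  obtain ⟨e, he⟩ := h
  intro v hv
  rcases hup : T.up v with _ | ⟨w, l⟩
  · rwa [(hroot v).1 hup]
  · have hw := hS w v ⟨l, hup⟩ hv
    have h1 := he ⟨v, hv⟩
    rw [DForest.restrict_up_eq_some (w := ⟨w, hw⟩).2 hup] at h1
    have h2 := DForest.restrict_up_eq_some.1 h1
    rw [hlab _ _ _ _ _ hup h2]
    exact (e ⟨v, hv⟩).2

/-! ### The states of the chains -/

variable [Fintype V]

theorem eta_companyState_mul (S : Finset V) :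
    eta (companyState T S).1 * (S.card.factorial : ℝ) =
      ((Fintype.card V).factorial : ℝ) * eta (T.restrict S).toClass := by
  have := eta_bullet_pow_mul (Fintype.card V - S.card) (T.restrict S).toClass
  rw [ForestClass.degree_toClass, Fintype.card_coe, Nat.add_sub_of_le (Finset.card_le_univ S)]
    at this
  exact this

theorem eta_companyState_pos (S : Finset V) : 0 < eta (companyState T S).1 := by
  have h1 := eta_companyState_mul (T := T) S
  have h2 := eta_restrict_pos T S
  have h3 : (0 : ℝ) < S.card.factorial := by positivity
  have h4 : (0 : ℝ) < (Fintype.card V).factorial := by positivity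
  exact pos_of_mul_pos_left (h1 ▸ mul_pos h4 h2) h3.le

/-- The indicator function of the structures whose state is `y`. -/
def stateIndicator (T : DForest L V) (y : Basis L (Fintype.card V)) (S : Finset V) : ℝ :=
  if companyState T S = y then 1 else 0

theorem basisVec_companyState (S : Finset V) :
    (basisVec (companyState T S).1 : CK L) =
      basisVec (ForestClass.bullet L) ^ (Fintype.card V - S.card) *
        basisVec (T.restrict S).toClass := by
  rw [← basisVec_pow, ← basisVec_mul]
  rfl

/-- The Doob transform of the operator `z ↦ •^k ∂^k z` removes `k` leaves one after the other. -/
theorem eta_div_mul_coeff (y : Basis L (Fintype.card V)) (k : ℕ) (S : Finset V) :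
    eta y.1 / eta (companyState T S).1 *
      coeffHom y.1 (basisVec (ForestClass.bullet L) ^ (Fintype.card V - S.card + k) *
        (leafDel L)^[k] (basisVec (T.restrict S).toClass)) =
      (S.card.descFactorial k : ℝ) * (leafStep T)^[k] (stateIndicator T y) S := by
  induction k generalizing S with
  | zero =>
    rw [Function.iterate_zero_apply, Function.iterate_zero_apply, add_zero,
      ← basisVec_companyState]
    change _ * (basisVec _ : CK L).coeff y.1 = _
    rw [basisVec_coeff, stateIndicator]
    by_cases h : companyState T S = y
    · rw [if_pos h, if_pos (congrArg Subtype.val h), h, div_self]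
      · simp
      · rw [← h]
        exact (eta_companyState_pos S).ne'
    · rw [if_neg h, if_neg fun h' => h (Subtype.ext h')]
      simp
  | succ k ih =>
    rw [leafDel_iterate_succ_restrict, Finset.mul_sum, map_sum, Finset.mul_sum,
      Function.iterate_succ_apply', leafStep, Finset.mul_sum]
    refine Finset.sum_congr rfl fun u hu => ?_
    have hc := card_erase_of_mem_leaves hu
    have hle := Finset.card_le_univ S
    -- Of the k + 1 factors •, one replaces the deleted leaf in the state of `S.erase u`.
    have hexp : Fintype.card V - S.card + (k + 1) =
        Fintype.card V - (S.erase u).card + k := by omega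
    have h1 := eta_companyState_mul (T := T) S
    have h2 := eta_companyState_mul (T := T) (S.erase u)
    have p1 := (eta_companyState_pos (T := T) S).ne'
    have p2 := (eta_companyState_pos (T := T) (S.erase u)).ne'
    have p3 := (eta_restrict_pos T S).ne'
    have hf : (((S.erase u).card).factorial : ℝ) ≠ 0 := by positivity
    have hfN : ((Fintype.card V).factorial : ℝ) ≠ 0 := by positivity
    rw [← hc, Nat.factorial_succ, Nat.cast_mul, hc] at h1
    -- The quotient of n₀!/(n-1)! by n₀!/n! is the factor n, which builds up the descending
    -- factorial.
    have hratio : eta (companyState T (S.erase u)).1 / eta (companyState T S).1 =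
        S.card * (eta (T.restrict (S.erase u)).toClass / eta (T.restrict S).toClass) := by
      rw [← mul_div_assoc, div_eq_div_iff p1 p3]
      apply mul_right_cancel₀ hf
      apply mul_right_cancel₀ hfN
      linear_combination (eta (T.restrict S).toClass * ((Fintype.card V).factorial : ℝ)) * h2 -
        ((Fintype.card V).factorial * eta (T.restrict (S.erase u)).toClass : ℝ) * h1
    have hdesc : (S.card.descFactorial (k + 1) : ℝ) =
        S.card * ((S.erase u).card.descFactorial k : ℝ) := by
      rw [← hc, Nat.succ_descFactorial_succ]
      push_cast
      ring
    have hsplit : eta y.1 / eta (companyState T S).1 =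
        eta (companyState T (S.erase u)).1 / eta (companyState T S).1 *
          (eta y.1 / eta (companyState T (S.erase u)).1) := by
      field_simp
    rw [hexp, hsplit, mul_assoc, ih, hratio, hdesc]
    ring

theorem drivenChain_T2R (S : Finset V) (y : Basis L (Fintype.card V)) :
    drivenChain (T2R L (Fintype.card V)) (companyState T S) y =
      (S.card : ℝ) / Fintype.card V * leafStep T (stateIndicator T y) S +
        ((Fintype.card V : ℝ) - S.card) / Fintype.card V * stateIndicator T y S := by
  have h0 := eta_div_mul_coeff (T := T) y 0 S
  have h1 := eta_div_mul_coeff (T := T) y 1 S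
  have h2 := T2R_basisVec (companyState T S).1
  rw [(companyState T S).2, basisVec_companyState, bullet_mul_leafDel,
    Nat.cast_sub (Finset.card_le_univ S)] at h2
  simp only [Function.iterate_zero_apply, Function.iterate_one, Nat.descFactorial_zero,
    Nat.descFactorial_one, add_zero, Nat.cast_one, one_mul] at h0 h1
  rw [drivenChain_apply, basisVec_companyState, h2, map_smul, map_add, map_smul, smul_eq_mul,
    smul_eq_mul, ← h0]
  linear_combination (1 / (Fintype.card V : ℝ)) * h1

theorem drivenChain_BinT2R (q : ℝ) (S : Finset V) (y : Basis L (Fintype.card V)) :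
    drivenChain (BinT2R L (Fintype.card V) q) (companyState T S) y =
      ∑ k ∈ Finset.range (S.card + 1),
        1 / (k.factorial : ℝ) * (1 - q) ^ k * q ^ (S.card - k) *
          ((S.card.descFactorial k : ℝ) * (leafStep T)^[k] (stateIndicator T y) S) := by
  have hdeg : (T.restrict S).toClass.degree = S.card := by
    rw [ForestClass.degree_toClass, Fintype.card_coe]
  have h := BinT2R_bullet_pow_mul (Fintype.card V - S.card) (T.restrict S).toClass q
  rw [BinT2R_basisVec, hdeg, Nat.sub_add_cancel (Finset.card_le_univ S)] at h
  rw [basisVec_mul, basisVec_pow, ← basisVec_companyState] at h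
  rw [drivenChain_apply, h, Finset.mul_sum, map_sum, Finset.mul_sum]
  refine Finset.sum_congr rfl fun k _ => ?_
  rw [mul_smul_comm, map_smul, ← mul_assoc, ← pow_add, smul_eq_mul, mul_left_comm,
    eta_div_mul_coeff]

/-- Both states are •^{n₀}, so the removal of a lone boss cannot be seen. -/
theorem companyState_empty_eq (r : V) : companyState T ∅ = companyState T {r} := by
  refine Subtype.ext ?_
  change ForestClass.bullet L ^ (Fintype.card V - (∅ : Finset V).card) * _ =
    ForestClass.bullet L ^ (Fintype.card V - ({r} : Finset V).card) * _
  have h1 : (T.restrict ∅).toClass = 1 :=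
    eq_one_of_degree (by simp [ForestClass.degree_toClass])
  have h2 : (T.restrict {r}).toClass = ForestClass.bullet L :=
    eq_bullet_of_degree (by rw [ForestClass.degree_toClass, Fintype.card_coe]; simp)
  have h3 : 0 < Fintype.card V := Fintype.card_pos_iff.2 ⟨r⟩
  rw [h1, h2, ← pow_succ, mul_one, Finset.card_empty, Finset.card_singleton, Nat.sub_zero,
    Nat.sub_add_cancel h3]

theorem DForest.exists_root {W : Type*} [Nonempty W] (F : DForest L W) : ∃ v, F.up v = none := by
  obtain ⟨m, -, hm⟩ := F.wf.has_min Set.univ Set.univ_nonempty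
  refine ⟨m, ?_⟩
  rcases h : F.up m with _ | ⟨w, l⟩
  · rfl
  · exact absurd ⟨l, h⟩ (hm w trivial)

theorem exists_two_roots {W : Type*} [Fintype W] {F : DForest L W} {z : ForestClass L}
    (hz : 0 < z.degree) (h : F.toClass = ForestClass.bullet L * z) :
    ∃ a b, a ≠ b ∧ F.up a = none ∧ F.up b = none := by
  induction z using ForestClass.ind with | _ n G
  rw [ForestClass.degree_toClass, Fintype.card_fin] at hz
  have : Nonempty (Fin n) := ⟨⟨0, hz⟩⟩
  obtain ⟨v, hv⟩ := G.exists_root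
  rw [ForestClass.bullet, ForestClass.toClass_mul_toClass, DForest.toClass_eq_iff] at h
  obtain ⟨e, he⟩ := h.symm
  refine ⟨e (Sum.inl 0), e (Sum.inr v), by simp, ?_, ?_⟩
  · rw [he]
    rfl
  · rw [he]
    simp [DForest.sum, hv]

theorem bullet_pow_mul_injective (k : ℕ) :
    Function.Injective fun x : ForestClass L => ForestClass.bullet L ^ k * x := by
  induction k with
  | zero => intro x y h; simpa using h
  | succ k ih =>
    intro x y h
    simp only [pow_succ', mul_assoc] at h
    exact ih (bullet_mul_injective h)

/-- If the sizes differed, cancelling • would write the larger tree as • times a nonempty forest,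
which has two roots. -/
theorem toClass_eq_of_companyState_eq {root : V} (hroot : ∀ v, T.up v = none ↔ v = root)
    {S S' : Finset V} (hne : S.Nonempty) (hS' : ParentClosed T S') (hle : S.card ≤ S'.card)
    (h : companyState T S = companyState T S') :
    (T.restrict S).toClass = (T.restrict S').toClass := by
  have h1 : ForestClass.bullet L ^ (Fintype.card V - S.card) * (T.restrict S).toClass =
    ForestClass.bullet L ^ (Fintype.card V - S'.card) * (T.restrict S').toClass :=
    congrArg Subtype.val h
  have hle' := Finset.card_le_univ S'
  obtain ⟨d, hd⟩ := Nat.exists_eq_add_of_le hle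
  rw [show Fintype.card V - S.card = Fintype.card V - S'.card + d by omega, pow_add,
    mul_assoc] at h1
  replace h1 := bullet_pow_mul_injective _ h1
  cases d with
  | zero => simpa using h1
  | succ d =>
    rw [pow_succ', mul_assoc] at h1
    obtain ⟨a, b, hab, ha, hb⟩ := exists_two_roots (by
      rw [ForestClass.degree_mul, ForestClass.degree_toClass, Fintype.card_coe]
      have := Finset.card_pos.2 hne
      omega) h1.symm
    exact absurd (Subtype.ext ((restrict_up_eq_none hroot hS' ha).trans
      (restrict_up_eq_none hroot hS' hb).symm)) hab

theorem companyState_eq_iff {root : V} (hroot : ∀ v, T.up v = none ↔ v = root)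
    {S S' : Finset V} (hS : ParentClosed T S) (hne : S.Nonempty) (hS' : ParentClosed T S')
    (hne' : S'.Nonempty) :
    companyState T S = companyState T S' ↔
      (T.restrict S).toClass = (T.restrict S').toClass := by
  constructor
  · intro h
    rcases le_total S.card S'.card with hle | hle
    · exact toClass_eq_of_companyState_eq hroot hne hS' hle h
    · exact (toClass_eq_of_companyState_eq hroot hne' hS hle h.symm).symm
  · intro h
    have hc := congrArg ForestClass.degree h
    simp only [ForestClass.degree_toClass, Fintype.card_coe] at hc
    refine Subtype.ext ?_
    change ForestClass.bullet L ^ _ * _ = ForestClass.bullet L ^ _ * _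
    rw [h, hc]

/-- The form in which the model enters the expectation identities: the filter on rooted subtrees is
void for weights carried by them. -/
theorem weightOfState_eq {root : V} (μ : Finset V → ℝ)
    (hμ : ∀ S', μ S' ≠ 0 → IsRootedSubtree T root S') (y : Basis L (Fintype.card V)) :
    weightOfState T root μ y = ∑ S', μ S' * stateIndicator T y S' := by
  rw [weightOfState, Finset.sum_filter]
  refine Finset.sum_congr rfl fun S' _ => ?_
  rw [stateIndicator]
  by_cases h : companyState T S' = y
  · by_cases h0 : μ S' = 0
    · simp [h0]
    · simp [h, hμ S' h0]
  · simp [h]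

end States

end CKTree

end

open CKTree in
theorem theorem5p2 {L V : Type*} [Finite L] [Fintype V] (T₀ : DForest L V) (root : V)
    (hroot : ∀ v, T₀.up v = none ↔ v = root) (q : ℝ) (hq₀ : 0 ≤ q) (hq₁ : q ≤ 1) :
    -- the starting state is that of the whole company
    (IsRootedSubtree T₀ root Finset.univ ∧ initialState T₀ = companyState T₀ Finset.univ) ∧
    -- `•^(n₀ - n) ⨿ T ↦ T` is well defined and injective
    (∀ S S', IsRootedSubtree T₀ root S → IsRootedSubtree T₀ root S' →
      (companyState T₀ S = companyState T₀ S' ↔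
        (T₀.restrict S).toClass = (T₀.restrict S').toClass)) ∧
    -- the two chains and the corresponding models
    (∀ (K : Matrix (Basis L (Fintype.card V)) (Basis L (Fintype.card V)) ℝ)
        (M : Matrix (Finset V) (Finset V) ℝ),
      (K = drivenChain (T2R L (Fintype.card V)) ∧ M = singleModel T₀) ∨
        (K = drivenChain (BinT2R L (Fintype.card V) q) ∧ M = binomialModel T₀ q) →
      (∀ (t : ℕ) (y : Basis L (Fintype.card V)), (K ^ t) (initialState T₀) y ≠ 0 →
        ∃ S, IsRootedSubtree T₀ root S ∧ y = companyState T₀ S) ∧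
      (∀ S S', IsRootedSubtree T₀ root S → M S S' ≠ 0 → IsRootedSubtree T₀ root S') ∧
      (∀ S, IsRootedSubtree T₀ root S → ∀ y,
        K (companyState T₀ S) y = weightOfState T₀ root (M S) y) ∧
      -- when the positions have distinct labels, states are literally vertex sets
      ((∀ v w a b l, T₀.up v = some (a, l) → T₀.up w = some (b, l) → v = w) →
        ∀ S S', IsRootedSubtree T₀ root S → IsRootedSubtree T₀ root S' →
          (companyState T₀ S = companyState T₀ S' ↔ S = S') ∧
          K (companyState T₀ S) (companyState T₀ S') = M S S')) ∧
    -- in the single model, the fired employee may also be chosen among the non-boss employees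
    (∀ S C S', IsRootedSubtree T₀ root S → 2 ≤ S.card → (∀ e, e ∈ C ↔ e ∈ S ∧ e ≠ root) →
      uniformFiring T₀ S S S' = uniformFiring T₀ C S S') := by
  classical
  have hr := belowEq_root hroot
  have hsub := @isRootedSubtree_iff L V T₀ root hroot
  have huniv : IsRootedSubtree T₀ root Finset.univ :=
    hsub.2 ⟨fun _ _ _ _ => Finset.mem_univ _, root, Finset.mem_univ _⟩
  have hinit : initialState T₀ = companyState T₀ Finset.univ := by
    refine Subtype.ext ?_
    change T₀.toClass = ForestClass.bullet L ^ (Fintype.card V - Finset.univ.card) * _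
    rw [Finset.card_univ, Nat.sub_self, pow_zero, one_mul, DForest.toClass_eq_iff]
    exact (DForest.restrict_univ_iso T₀).symm
  have hstate : ∀ S S', IsRootedSubtree T₀ root S → IsRootedSubtree T₀ root S' →
      (companyState T₀ S = companyState T₀ S' ↔
        (T₀.restrict S).toClass = (T₀.restrict S').toClass) := fun S S' hS hS' =>
    companyState_eq_iff hroot (hsub.1 hS).1 (hsub.1 hS).2 (hsub.1 hS').1 (hsub.1 hS').2
  refine ⟨⟨huniv, hinit⟩, hstate, ?_, ?_⟩
  · intro K M hKM
    have hM : ∀ S S', IsRootedSubtree T₀ root S → M S S' ≠ 0 → IsRootedSubtree T₀ root S' := by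
      intro S S' hS h
      rcases hKM with ⟨-, rfl⟩ | ⟨-, rfl⟩
      · exact hsub.2 (parentClosed_of_singleModel_ne_zero (hsub.1 hS).1 (hsub.1 hS).2 h)
      · exact hsub.2 (parentClosed_of_binomialModel_ne_zero (hsub.1 hS).1 (hsub.1 hS).2 h)
    have hK : ∀ S, IsRootedSubtree T₀ root S → ∀ y,
        K (companyState T₀ S) y = weightOfState T₀ root (M S) y := by
      intro S hS y
      -- The boundary condition on test functions holds because ∅ and {root} have the same state.
      have hg : stateIndicator T₀ y ∅ = stateIndicator T₀ y {root} := by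
        rw [stateIndicator, stateIndicator, companyState_empty_eq root]
      rw [weightOfState_eq _ fun S' => hM S S' hS]
      rcases hKM with ⟨rfl, rfl⟩ | ⟨rfl, rfl⟩
      · rw [drivenChain_T2R, sum_singleModel_mul hr (hsub.1 hS).1 (hsub.1 hS).2 _ hg]
      · rw [drivenChain_BinT2R,
          sum_binomialModel_mul hr hq₀ hq₁ (hsub.1 hS).1 (hsub.1 hS).2 _ hg]
    refine ⟨fun t => ?_, hM, hK, fun hlab S S' hS hS' => ?_⟩
    · induction t with
      | zero =>
        intro y hy
        refine ⟨Finset.univ, huniv, ?_⟩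
        rw [pow_zero] at hy
        rw [← hinit]
        by_contra hne
        exact hy (Matrix.one_apply_ne (Ne.symm hne))
      | succ t ih =>
        intro y hy
        rw [pow_succ, Matrix.mul_apply] at hy
        obtain ⟨z, -, hz⟩ := Finset.exists_ne_zero_of_sum_ne_zero hy
        obtain ⟨S, hS, rfl⟩ := ih z (left_ne_zero_of_mul hz)
        have h := right_ne_zero_of_mul hz
        -- A nonzero transition probability needs a nonempty sum, hence a rooted subtree whose state
        -- is `y`.
        rw [hK S hS, weightOfState] at h
        obtain ⟨S', hS', -⟩ := Finset.exists_ne_zero_of_sum_ne_zero h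
        rw [Finset.mem_filter] at hS'
        exact ⟨S', hS'.2.1, hS'.2.2.symm⟩
    · have heq : ∀ A B, IsRootedSubtree T₀ root A → IsRootedSubtree T₀ root B →
          (companyState T₀ A = companyState T₀ B ↔ A = B) := by
        intro A B hA hB
        refine ⟨fun h => ?_, fun h => by rw [h]⟩
        have hiso := DForest.toClass_eq_iff.1 ((hstate A B hA hB).1 h)
        exact (subset_of_restrict_iso hroot hlab (hsub.1 hA).1 hB.1 hiso).antisymm
          (subset_of_restrict_iso hroot hlab (hsub.1 hB).1 hA.1 hiso.symm)
      refine ⟨heq S S' hS hS', ?_⟩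
      rw [hK S hS, weightOfState, Finset.sum_eq_single S']
      · intro A hA hne
        rw [Finset.mem_filter] at hA
        exact absurd ((heq A S' hA.2.1 hS').1 hA.2.2) hne
      · intro h
        exact absurd (Finset.mem_filter.2 ⟨Finset.mem_univ _, hS', rfl⟩) h
  · intro S C S' hS h2 hC
    have hCe : C = S.erase root := by
      ext e
      rw [hC, Finset.mem_erase, and_comm]
    rw [hCe]
    convert uniformFiring_erase_root hr (hsub.1 hS).1 h2 S'
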